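/- Setting. Let $d_1\le\dots\le d_K$ and let $\phi_i:\mathcal X\times\mathcal A\to\mathbb R^{d_i}$ be feature maps such that $\phi_j$ has $\phi_i$ as its first $d_i$ coordinates for $i\le j$. Let $\mathcal F_i=\{(x,a)\mapsto\langle\beta,\phi_i(x,a)\rangle:\beta\in\mathbb R^{d_i}\}$, and let $i^*$ be the smallest index such that the true mean loss $(x,a)\mapsto\langle\beta^*,\phi_{i^*}(x,a)\rangle$, $\beta^*\in\mathbb R^{d_{i^*}}$, belongs to $\mathcal F_{i^*}$. Contexts $x_t$ are i.i.d. When the base learner $\mathcal A_i$ (a randomized contextual bandit algorithm) plays $a$ in the context $x_t$, the observed loss is $\ell_i(x_t,a)+\xi_t$, where $\xi_t$ is zero-mean and sub-Gaussian with variance proxy $1$, $\ell_i\in[0,1]$, and $\ell_i=\langle\beta^*,\phi_{i^*}\rangle$ for all $i\ge i^*$. For the misspecified classes $i<i^*$ the mean loss $\ell_i$ is arbitrary in $[0,1]$, for example $\ell_i=\langle\beta_i,\phi_i\rangle$ for some $\beta_i\in\mathbb R^{d_i}$, or again $\ell_i=\langle\beta^*,\phi_{i^*}\rangle$. Regret is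 measured against $\inf_{a\in\mathcal A}\langle\beta^*,\phi_{i^*}(x_t,a)\rangle$ in each round $t$. A corralling strategy for $K$ base learners selects, in each round, at random and on the basis of its previous selections and observed losses only, a base learner $i_t$, which plays the action $a_{i_t,t}$ that it proposes. The strategy observes the loss of this action, and then sends to each base learner either no feedback (the learner keeps its state), or a (possibly rescaled) loss with which the learner updates, or the command to restart. Theorem. Let $\alpha\ge 0$, $C>0$ and $p\in\mathbb N$. There are constants $C'$ and $p'$, depending on $\alpha$, $C$ and $p$ only, such that for all $T$, all $K\ge1$ and all $d_1,\dots,d_K$ there is a corralling strategy with the following property. Consider any problem as above, with any base learners such that for every $i\ge i^*$ and every $t\le T$ the expected regret of $\mathcal A_i$, run on its own for $t$ rounds, is at most $C\,d_i^{\alpha}\sqrt t\,(1+\log T)^p$. Then the expected regret of the strategy satisfies $$\mathbb E\Big[\sum_{t=1}^T\big(\ell_{i_t}(x_t,a_{i_t,t})-\inf_{a\in\mathcal A}\langle\beta^*,\phi_{i^*}(x_t,a)\rangle\big)\Big]\le C'\big(d_{i^*}^{2\alpha}\sqrt T+K\sqrt T\big)(1+\log T)^{p'}.$$ Moreover, if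 for every $i<i^*$ and all $(x,a)\in\mathcal X\times\mathcal A$ $$\ell_i(x,a)-\inf_{a'\in\mathcal A}\langle\beta^*,\phi_{i^*}(x,a')\rangle\ \ge\ 2\,\frac{d_{i^*}^{2\alpha}-d_i^{2\alpha}}{\sqrt T},$$ then the expected regret of the same strategy is at most $C'\big(d_{i^*}^{\alpha}\sqrt T+K\sqrt T\big)(1+\log T)^{p'}$. -/

import Mathlib

open MeasureTheory ProbabilityTheory

universe u v w

noncomputable section

namespace ModelSelection

/-! ### Product kernels -/

/-- The kernel that draws the coordinates `b i`, `i : ι`, independently, with `b i ∼ κ i a`. -/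
def piKernel {α : Type*} [MeasurableSpace α] {ι : Type*} [Fintype ι] {β : ι → Type*}
    [∀ i, MeasurableSpace (β i)] (κ : ∀ i, Kernel α (β i)) [∀ i, IsMarkovKernel (κ i)] :
    Kernel α (∀ i, β i) where
  toFun a := Measure.pi fun i => κ i a
  measurable' := by
    refine Measurable.measure_of_isPiSystem_of_isProbabilityMeasure
      generateFrom_pi.symm isPiSystem_pi ?_
    rintro s ⟨t, ht, rfl⟩
    simp only [Measure.pi_pi]
    exact Finset.measurable_prod _ fun i _ =>
      (κ i).measurable_coe (ht i (Set.mem_univ i))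

instance {α : Type*} [MeasurableSpace α] {ι : Type*} [Fintype ι] {β : ι → Type*}
    [∀ i, MeasurableSpace (β i)] (κ : ∀ i, Kernel α (β i)) [∀ i, IsMarkovKernel (κ i)] :
    IsMarkovKernel (piKernel κ) :=
  ⟨fun a => inferInstanceAs (IsProbabilityMeasure (Measure.pi fun i => κ i a))⟩

/-! ### The model selection problem for linear bandits -/

/-- The class of linear functions `(x, a) ↦ ⟨β, φ(x, a)⟩`, `β ∈ ℝⁿ`, of a feature map `φ`. -/
def linearClass {X : Type u} {A : Type v} {n : ℕ} (φ : X → A → EuclideanSpace ℝ (Fin n)) :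
    Set (X → A → ℝ) :=
  {f | ∃ β : EuclideanSpace ℝ (Fin n), ∀ x a, f x a = inner ℝ β (φ x a)}

/-- A stochastic linear bandit with nested feature maps of dimensions `d 0 ≤ d 1 ≤ …`.

`loss (i, x, a)` is the law of the loss that is observed when the base learner `i` plays the
action `a` in the context `x`. Its mean is `⟨β*, φ_{i*}(x, a)⟩` if `i* ≤ i`; for `i < i*`
(misspecified classes) the mean is an arbitrary number in `[0, 1]`. In particular, it
may be the same function `⟨β*, φ_{i*}(x, a)⟩` as for the other learners, and it may be of the form
`⟨β_i, φ_i(x, a)⟩` for some parameter `β_i`. -/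
structure Problem (X : Type u) (A : Type v) [MeasurableSpace X] [MeasurableSpace A]
    {K : ℕ} (d : Fin K → ℕ) where
  /-- the law of the contexts -/
  context : Measure X
  isProbabilityMeasure_context : IsProbabilityMeasure context
  /-- the feature maps -/
  feature : (i : Fin K) → X → A → EuclideanSpace ℝ (Fin (d i))
  dim_mono : Monotone d
  /-- for `i ≤ j`, the first `d i` coordinates of the `j`-th feature map are the `i`-th one -/
  nested : ∀ (i j : Fin K) (hij : i ≤ j) (x : X) (a : A) (k : Fin (d i)),
    feature j x a (Fin.castLE (dim_mono hij) k) = feature i x a k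
  /-- the smallest index of a class that contains the true mean loss -/
  iStar : Fin K
  /-- the optimal parameter -/
  betaStar : EuclideanSpace ℝ (Fin (d iStar))
  minimal : ∀ i < iStar,
    (fun x a => inner ℝ betaStar (feature iStar x a)) ∉ linearClass (feature i)
  /-- the law of the observed loss, given the learner, the context and the action -/
  loss : Kernel (Fin K × X × A) ℝ
  isMarkovKernel_loss : IsMarkovKernel loss
  mean_of_le : ∀ i, iStar ≤ i → ∀ x a,
    ∫ y, y ∂(loss (i, x, a)) = inner ℝ betaStar (feature iStar x a)
  mean_mem : ∀ i x a, ∫ y, y ∂(loss (i, x, a)) ∈ Set.Icc (0 : ℝ) 1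
  /-- the noise is sub-Gaussian with variance proxy `1` -/
  subgaussian : ∀ i x a,
    HasSubgaussianMGF (fun y => y - ∫ z, z ∂(loss (i, x, a))) 1 (loss (i, x, a))
  measurable_best : Measurable fun x => ⨅ a, inner ℝ betaStar (feature iStar x a)

attribute [instance] Problem.isProbabilityMeasure_context Problem.isMarkovKernel_loss

/-- A base learner, that is, a randomized contextual bandit algorithm: in the state `s` and the
context `x` it proposes an action `a ∼ act (s, x)`, and when it receives the feedback `y` for the
pair `(x, a)`, it moves to a new state drawn from `update (s, (x, a), y)`. -/
structure BaseLearner (X : Type u) (A : Type v) [MeasurableSpace X] [MeasurableSpace A] where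
  /-- the internal states, for example the histories of the learner -/
  State : Type w
  measurableSpace : MeasurableSpace State
  /-- the law of the initial state -/
  init : Measure State
  isProbabilityMeasure_init : IsProbabilityMeasure init
  act : Kernel (State × X) A
  isMarkovKernel_act : IsMarkovKernel act
  update : Kernel (State × (X × A) × ℝ) State
  isMarkovKernel_update : IsMarkovKernel update

attribute [instance] BaseLearner.measurableSpace BaseLearner.isProbabilityMeasure_init
  BaseLearner.isMarkovKernel_act BaseLearner.isMarkovKernel_update

/-- What a corralling strategy can tell a base learner at the end of a round: nothing, to
start anew, or to update with a given loss for the action that it proposed. -/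
inductive Command
  | skip
  | restart
  | feedback

instance : MeasurableSpace Command := ⊤

instance : DiscreteMeasurableSpace Command := ⟨fun _ => trivial⟩

instance : Countable Command :=
  ⟨fun c => Command.casesOn c 0 1 2, by
    intro a b h
    cases a <;> cases b <;> simp_all⟩

/-- A message to a base learner: a command, and the loss that is reported to the learner (which is
read only if the command is `feedback`). The reported loss may be a rescaled one. -/
abbrev Message : Type := Command × ℝ

/-- A randomized corralling strategy for `K` base learners. In the state `s` it selects the base
learner `i ∼ select s`; it then observes only the loss `y` of the action that this learner plays
(neither the context nor the actions), and draws its new state and the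
messages to all the base learners from `update (s, i, y)`. -/
structure Strategy (K : ℕ) where
  /-- the internal states, for example the histories of selections and losses -/
  State : Type
  measurableSpace : MeasurableSpace State
  /-- the law of the initial state -/
  init : Measure State
  isProbabilityMeasure_init : IsProbabilityMeasure init
  select : Kernel State (Fin K)
  isMarkovKernel_select : IsMarkovKernel select
  update : Kernel (State × Fin K × ℝ) (State × (Fin K → Message))
  isMarkovKernel_update : IsMarkovKernel update

attribute [instance] Strategy.measurableSpace Strategy.isProbabilityMeasure_init
  Strategy.isMarkovKernel_select Strategy.isMarkovKernel_update

namespace Problem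

variable {X : Type u} {A : Type v} [MeasurableSpace X] [MeasurableSpace A] {K : ℕ} {d : Fin K → ℕ}

/-- The mean loss when the base learner `i` plays the action `a` in the context `x`. -/
def mean (P : Problem X A d) (i : Fin K) (x : X) (a : A) : ℝ := ∫ y, y ∂(P.loss (i, x, a))

/-- The smallest mean loss in the context `x`. -/
def best (P : Problem X A d) (x : X) : ℝ :=
  ⨅ a, inner ℝ P.betaStar (P.feature P.iStar x a)

/-- The gap assumption on the misspecified classes. -/
def Gap (P : Problem X A d) (α : ℝ) (T : ℕ) : Prop :=
  ∀ i < P.iStar, ∀ x a,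
    2 * ((d P.iStar : ℝ) ^ (2 * α) - (d i : ℝ) ^ (2 * α)) / √T ≤ P.mean i x a - P.best x

end Problem

/-! ### A base learner on its own -/

section Solo

variable {X : Type u} {A : Type v} [MeasurableSpace X] [MeasurableSpace A] {K : ℕ} {d : Fin K → ℕ}

/-- The context and the action of a round, given the state of the learner. -/
def soloPlay (P : Problem X A d) (L : BaseLearner.{u, v, w} X A) : Kernel L.State (X × A) :=
  Kernel.const L.State P.context ⊗ₖ L.act

/-- The observed loss of the round, in addition. -/
def soloRound (P : Problem X A d) (i : Fin K) (L : BaseLearner.{u, v, w} X A) :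
    Kernel L.State ((X × A) × ℝ) :=
  soloPlay P L ⊗ₖ P.loss.comap (fun p : L.State × (X × A) => (i, p.2)) (by fun_prop)

/-- The transition kernel of the learner when it receives its own observed loss as feedback. -/
def soloStep (P : Problem X A d) (i : Fin K) (L : BaseLearner.{u, v, w} X A) :
    Kernel L.State L.State :=
  (soloRound P i L ⊗ₖ L.update).snd

/-- The law of the state of the learner after `t` rounds. -/
def soloLaw (P : Problem X A d) (i : Fin K) (L : BaseLearner.{u, v, w} X A) : ℕ → Measure L.State
  | 0 => L.init
  | t + 1 => (soloLaw P i L t).bind (soloStep P i L)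

/-- The expected regret over `t` rounds of the base learner `L` (with index `i`) on its own. -/
def soloRegret (P : Problem X A d) (i : Fin K) (L : BaseLearner.{u, v, w} X A) (t : ℕ) : ℝ :=
  ∑ s ∈ Finset.range t,
    ∫ z, (P.mean i z.2.1 z.2.2 - P.best z.2.1) ∂(soloLaw P i L s ⊗ₘ soloPlay P L)

end Solo

/-! ### Corralling -/

section Corral

variable {X : Type u} {A : Type v} [MeasurableSpace X] [MeasurableSpace A] {K : ℕ} {d : Fin K → ℕ}

/-- The reaction of a base learner, with its proposal `(x, a)` of the round, to a message. -/
def respond (L : BaseLearner.{u, v, w} X A) :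
    Kernel ((L.State × (X × A)) × Message) L.State where
  toFun p :=
    match p.2.1 with
    | Command.skip => Measure.dirac p.1.1
    | Command.restart => L.init
    | Command.feedback => L.update (p.1.1, p.1.2, p.2.2)
  measurable' := by
    have h : Measurable fun q : ((L.State × (X × A)) × ℝ) × Command =>
        (match q.2 with
        | Command.skip => Measure.dirac q.1.1.1
        | Command.restart => L.init
        | Command.feedback => L.update (q.1.1.1, q.1.1.2, q.1.2) : Measure L.State) := by
      refine measurable_from_prod_countable_left fun c => ?_
      cases c with
      | skip => exact Measure.measurable_dirac.comp (by fun_prop)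
      | restart => exact measurable_const
      | feedback => exact L.update.measurable.comp (by fun_prop)
    have hg : Measurable fun p : (L.State × (X × A)) × Message => ((p.1, p.2.2), p.2.1) := by
      fun_prop
    exact h.comp hg

instance (L : BaseLearner.{u, v, w} X A) : IsMarkovKernel (respond L) := by
  refine ⟨fun p => ?_⟩
  obtain ⟨⟨s, z⟩, c, y⟩ := p
  cases c
  · exact inferInstanceAs (IsProbabilityMeasure (Measure.dirac s))
  · exact inferInstanceAs (IsProbabilityMeasure L.init)
  · exact inferInstanceAs (IsProbabilityMeasure (L.update (s, z, y)))

/-- The joint states of the base learners and the corralling strategy. -/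
abbrev JointState (L : Fin K → BaseLearner.{u, v, w} X A) (S : Strategy K) : Type w :=
  (∀ i, (L i).State) × S.State

/-- The context of a round and the actions that the base learners propose. -/
def corralProposals (P : Problem X A d) (L : Fin K → BaseLearner.{u, v, w} X A) (S : Strategy K) :
    Kernel (JointState L S) (X × (Fin K → A)) :=
  Kernel.const (JointState L S) P.context ⊗ₖ
    piKernel fun i => (L i).act.comap
      (fun p : JointState L S × X => (p.1.1 i, p.2)) (by fun_prop)

/-- In addition, the base learner that the strategy selects. -/
def corralPlay (P : Problem X A d) (L : Fin K → BaseLearner.{u, v, w} X A) (S : Strategy K) :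
    Kernel (JointState L S) ((X × (Fin K → A)) × Fin K) :=
  corralProposals P L S ⊗ₖ
    S.select.comap (fun p : JointState L S × (X × (Fin K → A)) => p.1.2) (by fun_prop)

lemma measurable_played : Measurable fun q : (X × (Fin K → A)) × Fin K =>
    ((q.2, q.1.1, q.1.2 q.2) : Fin K × X × A) :=
  measurable_from_prod_countable_left fun i =>
    measurable_const.prodMk (measurable_fst.prodMk ((measurable_pi_apply i).comp measurable_snd))

/-- In addition, the observed loss of the action of the selected base learner. -/
def corralRound (P : Problem X A d) (L : Fin K → BaseLearner.{u, v, w} X A) (S : Strategy K) :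
    Kernel (JointState L S) (((X × (Fin K → A)) × Fin K) × ℝ) :=
  corralPlay P L S ⊗ₖ
    P.loss.comap (fun p : JointState L S × ((X × (Fin K → A)) × Fin K) =>
        ((p.2.2, p.2.1.1, p.2.1.2 p.2.2) : Fin K × X × A))
      (measurable_played.comp measurable_snd)

/-- In addition, the new state of the strategy and its messages to the base learners. -/
def corralMessages (P : Problem X A d) (L : Fin K → BaseLearner.{u, v, w} X A) (S : Strategy K) :
    Kernel (JointState L S)
      ((((X × (Fin K → A)) × Fin K) × ℝ) × (S.State × (Fin K → Message))) :=
  corralRound P L S ⊗ₖ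
    S.update.comap (fun p : JointState L S × (((X × (Fin K → A)) × Fin K) × ℝ) =>
      (p.1.2, p.2.1.2, p.2.2)) (by fun_prop)

/-- The transition kernel of the joint state: the base learners react to their messages. -/
def corralStep (P : Problem X A d) (L : Fin K → BaseLearner.{u, v, w} X A) (S : Strategy K) :
    Kernel (JointState L S) (JointState L S) :=
  (corralMessages P L S ⊗ₖ
    piKernel fun i => (respond (L i)).comap
      (fun p : JointState L S ×
          ((((X × (Fin K → A)) × Fin K) × ℝ) × (S.State × (Fin K → Message))) =>
        ((p.1.1 i, (p.2.1.1.1.1, p.2.1.1.1.2 i)), p.2.2.2 i)) (by fun_prop)).map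
    fun q => (q.2, q.1.2.1)

/-- The law of the joint state after `t` rounds. -/
def corralLaw (P : Problem X A d) (L : Fin K → BaseLearner.{u, v, w} X A) (S : Strategy K) :
    ℕ → Measure (JointState L S)
  | 0 => (Measure.pi fun i => (L i).init).prod S.init
  | t + 1 => (corralLaw P L S t).bind (corralStep P L S)

/-- The expected regret over `T` rounds of the corralling strategy `S` with base learners `L`. -/
def corralRegret (P : Problem X A d) (L : Fin K → BaseLearner.{u, v, w} X A) (S : Strategy K)
    (T : ℕ) : ℝ :=
  ∑ t ∈ Finset.range T,
    ∫ z, (P.mean z.2.2 z.2.1.1 (z.2.1.2 z.2.2) - P.best z.2.1.1)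
      ∂(corralLaw P L S t ⊗ₘ corralPlay P L S)

end Corral

end ModelSelection

end

noncomputable section

namespace ModelSelection

/-! ### Bounded measurable functions -/

/-! Base learners matter only through the dyadic scale of their regret. Arm `j` is represented by
the learner of largest index with `d i ^ α < 2 ^ (j + 1)`. With `k = bestArm`, the arms `j ≥ k` are
well-specified, and only about `log T` arms are relevant. In phase `b` the arms above `b` are
explored, the costliest first, in blocks with freshly started learners; then arm `b` is played.
Losses of a well-specified learner rarely fall much below the optimal value, so its blocks give
upper confidence bounds `W` of that value. When the losses of arm `j` exceed the budget set by `W`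
by more than `thr j`, arm `j` and all cheaper ones are discarded, and phase `j + 1` begins.

Three facts carry the bound, with `Q` the number of exploration blocks.

(1) In phase `b` a block of a well-specified arm `j` is so short that it costs `C * R * 2 ^ b * √T`,
not `2 ^ j * √T`. By Markov's inequality it raises a false alarm with probability at most `2 ^ b /
(2 ^ (j + 2) * (Q + 1))`, while the phase `j + 1` that follows costs `2 * (Q + 1) * (C * R + 1) * 2
^ (j + 1) * √T`. The product is again of order `C * R * 2 ^ b * √T`, so a backward induction over
phases closes (`restartValue_phaseStart_le_of_le`).

(2) Each block of arm `k` makes `W` accurate up to some `ε` except with probability 1/2, again by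
Markov. After `copies > log₂ T` blocks the failure costs at most `T / 2 ^ copies ≤ 1`
(`restartValue_phaseStart_le_of_lt`).

(3) Misspecified arms come after arm `k`. With an accurate `W`, their regret before the alarm is at
most `thr j + N * ε` plus an overshoot of order `√T`. Since `T * ε` is of order `4 ^ k * √T` up to
logarithms, the first bound follows (`exists_drift`). Under the gap assumption and for large `2 ^
k`, an arm `j < k - 1` has regret at least `2 * ε` per round, so the regret is at most twice its
excess over `ε` and the term `N * ε` disappears. For `j = k - 1` the block is too short for `N * ε`
to hurt (`exists_drift_of_gap`). Alarms of misspecified arms raise the phase, hence occur at most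
`k` times.

The probabilistic part uses value functions instead of stopping times. Unselected learners keep
their state, so a block is a solo run (`integral_corralStep`). The regret to come is then bounded by
induction on the remaining rounds, with explicit potentials built from the remaining solo regret,
the excess loss, and exponentials or second moments (`blockValue_le_of_wellSpecified`,
`blockValue_le_of_accurate`). -/

lemma integrable_of_abs_le {α : Type*} [MeasurableSpace α] {μ : Measure α} [IsFiniteMeasure μ]
    {f : α → ℝ} (hf : Measurable f) {B : ℝ} (hB : ∀ x, |f x| ≤ B) : Integrable f μ :=
  Integrable.of_bound hf.aestronglyMeasurable B (.of_forall hB)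

lemma abs_integral_le_of_abs_le {α : Type*} [MeasurableSpace α] {μ : Measure α}
    [IsProbabilityMeasure μ] {f : α → ℝ} {B : ℝ} (hB : ∀ x, |f x| ≤ B) : |∫ x, f x ∂μ| ≤ B := by
  simpa using norm_integral_le_of_norm_le_const (μ := μ) (f := f) (.of_forall hB)

lemma measurable_integral_kernel {α β : Type*} [MeasurableSpace α] [MeasurableSpace β]
    (κ : Kernel α β) [IsSFiniteKernel κ] {f : β → ℝ} (hf : Measurable f) :
    Measurable fun a => ∫ b, f b ∂(κ a) :=
  (hf.stronglyMeasurable.integral_kernel (κ := κ)).measurable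

lemma integral_bind_of_abs_le {α β : Type*} [MeasurableSpace α] [MeasurableSpace β]
    {μ : Measure α} [IsProbabilityMeasure μ] (κ : Kernel α β) [IsMarkovKernel κ] {f : β → ℝ}
    (hf : Measurable f) {B : ℝ} (hB : ∀ x, |f x| ≤ B) :
    ∫ b, f b ∂(μ.bind κ) = ∫ a, ∫ b, f b ∂(κ a) ∂μ := by
  have h := Measure.snd_compProd μ κ
  rw [← h, Measure.snd, integral_map measurable_snd.aemeasurable hf.aestronglyMeasurable,
    Measure.integral_compProd]
  exact integrable_of_abs_le (hf.comp measurable_snd) fun x => hB _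

/-! ### Accumulated costs along a Markov chain -/

/-- The expected cost `g` accumulated over `r` rounds of the Markov chain with kernel `κ`. -/
def costToGo {Z : Type*} [MeasurableSpace Z] (g : Z → ℝ) (κ : Kernel Z Z) : ℕ → Z → ℝ
  | 0 => fun _ => 0
  | r + 1 => fun z => g z + ∫ z', costToGo g κ r z' ∂(κ z)

section Chain

variable {Z : Type*} [MeasurableSpace Z] {g : Z → ℝ} {κ : Kernel Z Z} [IsMarkovKernel κ]

lemma measurable_costToGo (hg : Measurable g) (r : ℕ) : Measurable (costToGo g κ r) := by
  induction r with
  | zero => exact measurable_const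
  | succ r ih => exact hg.add (measurable_integral_kernel κ ih)

lemma abs_costToGo_le {B : ℝ} (hB : ∀ z, |g z| ≤ B) (r : ℕ) (z : Z) :
    |costToGo g κ r z| ≤ r * B := by
  induction r generalizing z with
  | zero => simp [costToGo]
  | succ r ih =>
    calc |costToGo g κ (r + 1) z| ≤ |g z| + |∫ z', costToGo g κ r z' ∂(κ z)| := abs_add_le _ _
      _ ≤ B + r * B := add_le_add (hB z) (abs_integral_le_of_abs_le ih)
      _ = (r + 1 : ℕ) * B := by push_cast; ring

omit [IsMarkovKernel κ] in
lemma costToGo_nonneg (hg : ∀ z, 0 ≤ g z) (r : ℕ) (z : Z) : 0 ≤ costToGo g κ r z := by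
  induction r generalizing z with
  | zero => exact le_rfl
  | succ r ih => exact add_nonneg (hg z) (integral_nonneg ih)

/-- Turns a forward sum over marginal laws into a backward value function, so that regret can be
bounded by induction on the number of remaining rounds. -/
lemma sum_integral_eq_integral_costToGo (hg : Measurable g) {B : ℝ} (hB : ∀ z, |g z| ≤ B)
    (μ : ℕ → Measure Z) [IsProbabilityMeasure (μ 0)] (hμ : ∀ t, μ (t + 1) = (μ t).bind κ) (r : ℕ) :
    ∑ t ∈ Finset.range r, ∫ z, g z ∂(μ t) = ∫ z, costToGo g κ r z ∂(μ 0) := by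
  have hprob : ∀ t, IsProbabilityMeasure (μ t) := by
    intro t
    induction t with
    | zero => infer_instance
    | succ t ih => rw [hμ]; infer_instance
  have key : ∀ r t, ∑ s ∈ Finset.range r, ∫ z, g z ∂(μ (t + s)) =
      ∫ z, costToGo g κ r z ∂(μ t) := by
    intro r
    induction r with
    | zero => intro t; simp [costToGo]
    | succ r ih =>
      intro t
      have := hprob t
      rw [Finset.sum_range_succ']
      have h1 : ∀ s, ∫ z, g z ∂(μ (t + (s + 1))) = ∫ z, g z ∂(μ (t + 1 + s)) := fun s => by
        rw [add_right_comm, add_assoc]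
      rw [Finset.sum_congr rfl fun s _ => h1 s, ih (t + 1)]
      simp only [costToGo, add_zero]
      rw [hμ, integral_bind_of_abs_le κ (measurable_costToGo hg r) (abs_costToGo_le hB r),
        integral_add (integrable_of_abs_le hg hB)
          (integrable_of_abs_le (measurable_integral_kernel κ (measurable_costToGo hg r))
            fun z => abs_integral_le_of_abs_le (abs_costToGo_le hB r)), add_comm]
  simpa using key r 0

end Chain

/-! ### The mean losses -/

namespace Problem

variable {X : Type u} {A : Type v} [MeasurableSpace X] [MeasurableSpace A] {K : ℕ} {d : Fin K → ℕ}
  (P : Problem X A d)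

/-- The expected smallest mean loss. -/
def value : ℝ := ∫ x, P.best x ∂P.context

lemma measurable_mean : Measurable fun p : Fin K × X × A => P.mean p.1 p.2.1 p.2.2 :=
  measurable_integral_kernel P.loss measurable_id

lemma measurable_mean_right (i : Fin K) : Measurable fun p : X × A => P.mean i p.1 p.2 :=
  P.measurable_mean.comp (measurable_const.prodMk measurable_id)

lemma measurable_best' : Measurable P.best := P.measurable_best

lemma mean_mem_Icc (i : Fin K) (x : X) (a : A) : P.mean i x a ∈ Set.Icc (0 : ℝ) 1 :=
  P.mean_mem i x a

lemma mean_eq_inner {i : Fin K} (hi : P.iStar ≤ i) (x : X) (a : A) :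
    P.mean i x a = inner ℝ P.betaStar (P.feature P.iStar x a) := P.mean_of_le i hi x a

lemma best_eq (x : X) : P.best x = ⨅ a, P.mean P.iStar x a := by
  simp only [best, P.mean_eq_inner le_rfl]

lemma best_nonneg (x : X) : 0 ≤ P.best x := by
  rw [best_eq]
  exact Real.iInf_nonneg fun a => (P.mean_mem_Icc _ x a).1

/-- Restricted to well-specified indices: a misspecified mean may lie below `best`, so the regret of
such a learner has no sign. -/
lemma best_le_mean {i : Fin K} (hi : P.iStar ≤ i) (x : X) (a : A) : P.best x ≤ P.mean i x a := by
  rw [P.mean_eq_inner hi, ← P.mean_eq_inner le_rfl, best_eq]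
  exact ciInf_le ⟨0, by rintro _ ⟨b, rfl⟩; exact (P.mean_mem_Icc _ x b).1⟩ a

lemma best_le_one (x : X) : P.best x ≤ 1 := by
  rcases isEmpty_or_nonempty A with h | ⟨⟨a⟩⟩
  · simp [best, Real.iInf_of_isEmpty]
  · exact (P.best_le_mean le_rfl x a).trans (P.mean_mem_Icc _ x a).2

lemma abs_best_le (x : X) : |P.best x| ≤ 1 :=
  abs_le.2 ⟨by linarith [P.best_nonneg x], P.best_le_one x⟩

lemma abs_mean_sub_best_le (i : Fin K) (x : X) (a : A) : |P.mean i x a - P.best x| ≤ 1 := by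
  have h := P.mean_mem_Icc i x a
  exact abs_le.2 ⟨by linarith [h.1, P.best_le_one x], by linarith [h.2, P.best_nonneg x]⟩

lemma value_nonneg : 0 ≤ P.value := integral_nonneg P.best_nonneg

lemma value_le_one : P.value ≤ 1 :=
  (abs_le.1 (abs_integral_le_of_abs_le P.abs_best_le)).2

lemma abs_mean_sub_value_le (i : Fin K) (x : X) (a : A) : |P.mean i x a - P.value| ≤ 1 := by
  have h := P.mean_mem_Icc i x a
  exact abs_le.2 ⟨by linarith [h.1, P.value_le_one], by linarith [h.2, P.value_nonneg]⟩

lemma integrable_loss (i : Fin K) (x : X) (a : A) : Integrable id (P.loss (i, x, a)) := by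
  have h := (P.subgaussian i x a).integrable.add (integrable_const (∫ z, z ∂(P.loss (i, x, a))))
  exact h.congr (.of_forall fun y => by simp)

lemma exp_mul_sub_value (i : Fin K) (x : X) (a : A) (t y : ℝ) :
    Real.exp (t * (y - P.value)) =
      Real.exp (t * (P.mean i x a - P.value)) * Real.exp (t * (y - P.mean i x a)) := by
  rw [← Real.exp_add]; ring_nf

lemma integrable_exp_loss (i : Fin K) (x : X) (a : A) (t : ℝ) :
    Integrable (fun y => Real.exp (t * (y - P.value))) (P.loss (i, x, a)) := by
  rw [funext fun y => P.exp_mul_sub_value i x a t y]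
  exact ((P.subgaussian i x a).integrable_exp_mul t).const_mul _

lemma integral_exp_loss_le (i : Fin K) (x : X) (a : A) (t : ℝ) :
    ∫ y, Real.exp (t * (y - P.value)) ∂(P.loss (i, x, a)) ≤
      Real.exp (t * (P.mean i x a - P.value)) * Real.exp (t ^ 2 / 2) := by
  rw [funext fun y => P.exp_mul_sub_value i x a t y]
  rw [integral_const_mul]
  refine mul_le_mul_of_nonneg_left ?_ (Real.exp_nonneg _)
  simpa [mgf, mean] using (P.subgaussian i x a).mgf_le t

/-- Hoeffding's lemma for a variable in `[0, 1]`, with the exponent `t ^ 2 / 8` weakened to `t ^ 2 /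
2`. -/
lemma integral_exp_best_le (t : ℝ) :
    ∫ x, Real.exp (t * (P.best x - P.value)) ∂P.context ≤ Real.exp (t ^ 2 / 2) := by
  have h := (hasSubgaussianMGF_of_mem_Icc (μ := P.context) (a := 0) (b := 1)
    P.measurable_best'.aemeasurable
    (.of_forall fun x => ⟨P.best_nonneg x, P.best_le_one x⟩)).mgf_le t
  refine h.trans (Real.exp_le_exp.2 ?_)
  simp
  nlinarith [sq_nonneg t]

end Problem

/-! ### One round of a base learner -/

section Solo

variable {X : Type u} {A : Type v} [MeasurableSpace X] [MeasurableSpace A] {K : ℕ} {d : Fin K → ℕ}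
  (P : Problem X A d) (i : Fin K) (L : BaseLearner.{u, v, w} X A)

instance : IsMarkovKernel (soloPlay P L) := by unfold soloPlay; infer_instance
instance : IsMarkovKernel (soloRound P i L) := by unfold soloRound; infer_instance
instance : IsMarkovKernel (soloStep P i L) := by unfold soloStep; infer_instance

/-- The expected regret of a round in the state `s`. -/
def roundRegret (s : L.State) : ℝ := ∫ z, (P.mean i z.1 z.2 - P.best z.1) ∂(soloPlay P L s)

/-- The expected regret over `t` rounds, started in the state `s`. -/
def regretToGo (t : ℕ) (s : L.State) : ℝ := costToGo (roundRegret P i L) (soloStep P i L) t s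

lemma measurable_mean_sub_best : Measurable fun z : X × A => P.mean i z.1 z.2 - P.best z.1 :=
  (P.measurable_mean_right i).sub (P.measurable_best'.comp measurable_fst)

lemma measurable_roundRegret : Measurable (roundRegret P i L) :=
  measurable_integral_kernel _ (measurable_mean_sub_best P i)

lemma abs_roundRegret_le (s : L.State) : |roundRegret P i L s| ≤ 1 :=
  abs_integral_le_of_abs_le fun _ => P.abs_mean_sub_best_le i _ _

lemma roundRegret_nonneg (hi : P.iStar ≤ i) (s : L.State) : 0 ≤ roundRegret P i L s :=
  integral_nonneg fun _ => sub_nonneg.2 (P.best_le_mean hi _ _)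

lemma measurable_regretToGo (t : ℕ) : Measurable (regretToGo P i L t) :=
  measurable_costToGo (measurable_roundRegret P i L) t

lemma abs_regretToGo_le (t : ℕ) (s : L.State) : |regretToGo P i L t s| ≤ t := by
  simpa [regretToGo] using
    abs_costToGo_le (κ := soloStep P i L) (abs_roundRegret_le P i L) t s

lemma regretToGo_nonneg (hi : P.iStar ≤ i) (t : ℕ) (s : L.State) : 0 ≤ regretToGo P i L t s :=
  costToGo_nonneg (roundRegret_nonneg P i L hi) t s

lemma soloRegret_eq (t : ℕ) : soloRegret P i L t = ∫ s, regretToGo P i L t s ∂L.init := by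
  have hprob : ∀ t, IsProbabilityMeasure (soloLaw P i L t) := by
    intro t
    induction t with
    | zero => exact L.isProbabilityMeasure_init
    | succ t ih => unfold soloLaw; infer_instance
  have : IsProbabilityMeasure (soloLaw P i L 0) := hprob 0
  have h := sum_integral_eq_integral_costToGo (κ := soloStep P i L) (measurable_roundRegret P i L)
    (abs_roundRegret_le P i L) (soloLaw P i L) (fun _ => rfl) t
  refine Eq.trans ?_ h
  refine Finset.sum_congr rfl fun s _ => ?_
  have := hprob s
  rw [Measure.integral_compProd]
  · rfl
  · exact integrable_of_abs_le ((measurable_mean_sub_best P i).comp measurable_snd)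
      fun _ => P.abs_mean_sub_best_le i _ _

/-- Integrals over a round, as iterated integrals. -/
lemma integral_soloPlay {f : X × A → ℝ} (hf : Measurable f) {B : ℝ} (hB : ∀ z, |f z| ≤ B)
    (s : L.State) :
    ∫ z, f z ∂(soloPlay P L s) = ∫ x, ∫ a, f (x, a) ∂(L.act (s, x)) ∂P.context := by
  unfold soloPlay
  rw [integral_compProd (integrable_of_abs_le hf hB)]
  simp

lemma integral_soloPlay_fst {f : X → ℝ} (hf : Measurable f) {B : ℝ} (hB : ∀ z, |f z| ≤ B)
    (s : L.State) : ∫ z, f z.1 ∂(soloPlay P L s) = ∫ x, f x ∂P.context := by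
  rw [integral_soloPlay P L (f := fun z => f z.1) (hf.comp measurable_fst) fun z => hB z.1]
  simp

lemma integral_soloRound {f : (X × A) × ℝ → ℝ} {s : L.State}
    (hf : Integrable f (soloRound P i L s)) :
    ∫ z, f z ∂(soloRound P i L s) =
      ∫ z, ∫ y, f (z, y) ∂(P.loss (i, z)) ∂(soloPlay P L s) := by
  unfold soloRound at hf ⊢
  rw [integral_compProd hf]
  simp [Kernel.comap_apply]

lemma abs_exp_mul_le {t b : ℝ} (hb : |b| ≤ 1) : |Real.exp (t * b)| ≤ Real.exp |t| := by
  rw [abs_of_pos (Real.exp_pos _)]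
  refine Real.exp_le_exp.2 ((le_abs_self _).trans ?_)
  rw [abs_mul]
  exact mul_le_of_le_one_right (abs_nonneg _) hb

lemma integral_exp_loss_le_const (x : X) (a : A) (t : ℝ) :
    ∫ y, Real.exp (t * (y - P.value)) ∂(P.loss (i, x, a)) ≤ Real.exp |t| * Real.exp (t ^ 2 / 2) :=
  (P.integral_exp_loss_le i x a t).trans <| mul_le_mul_of_nonneg_right
    ((le_abs_self _).trans (abs_exp_mul_le (P.abs_mean_sub_value_le i x a))) (Real.exp_nonneg _)

lemma integrable_exp_soloRound (s : L.State) (t : ℝ) :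
    Integrable (fun z => Real.exp (t * (z.2 - P.value))) (soloRound P i L s) := by
  unfold soloRound
  have hm : Measurable fun y : ℝ => Real.exp (t * (y - P.value)) := by fun_prop
  rw [integrable_compProd_iff (f := fun z : (X × A) × ℝ => Real.exp (t * (z.2 - P.value)))
    (hm.comp measurable_snd).aestronglyMeasurable]
  refine ⟨.of_forall fun z => by
    simpa [Kernel.comap_apply] using P.integrable_exp_loss i z.1 z.2 t, ?_⟩
  simp only [Real.norm_eq_abs, abs_of_pos (Real.exp_pos _), Kernel.comap_apply]
  refine integrable_of_abs_le (B := Real.exp |t| * Real.exp (t ^ 2 / 2))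
    ((measurable_integral_kernel P.loss hm).comp (measurable_const.prodMk measurable_id))
    fun z => ?_
  rw [abs_of_nonneg (integral_nonneg fun y => Real.exp_nonneg _)]
  exact integral_exp_loss_le_const P i z.1 z.2 t

lemma integral_exp_soloRound_le (s : L.State) (t : ℝ) :
    ∫ z, Real.exp (t * (z.2 - P.value)) ∂(soloRound P i L s) ≤
      Real.exp |t| * Real.exp (t ^ 2 / 2) := by
  rw [integral_soloRound P i L (integrable_exp_soloRound P i L s t)]
  refine (le_abs_self _).trans (abs_integral_le_of_abs_le fun z => ?_)
  rw [abs_of_nonneg (integral_nonneg fun y => Real.exp_nonneg _)]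
  exact integral_exp_loss_le_const P i z.1 z.2 t

/-- The losses of a well-specified learner are not much smaller than the optimal value. -/
lemma integral_exp_neg_soloRound_le (hi : P.iStar ≤ i) (s : L.State) {t : ℝ} (ht : 0 ≤ t) :
    ∫ z, Real.exp (-t * (z.2 - P.value)) ∂(soloRound P i L s) ≤ Real.exp (t ^ 2) := by
  have hbm : Measurable fun x => Real.exp (-t * (P.best x - P.value)) := by
    have := P.measurable_best'
    fun_prop
  have hbb : ∀ x, |Real.exp (-t * (P.best x - P.value))| ≤ Real.exp |-t| := fun x =>
    abs_exp_mul_le (abs_le.2 ⟨by linarith [P.best_nonneg x, P.value_le_one],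
      by linarith [P.best_le_one x, P.value_nonneg]⟩)
  rw [integral_soloRound P i L (integrable_exp_soloRound P i L s (-t))]
  have hm : Measurable fun z : X × A =>
      ∫ y, Real.exp (-t * (y - P.value)) ∂(P.loss (i, z)) :=
    (measurable_integral_kernel P.loss (by fun_prop)).comp (measurable_const.prodMk measurable_id)
  calc _ ≤ ∫ z, Real.exp (-t * (P.best z.1 - P.value)) * Real.exp (t ^ 2 / 2)
        ∂(soloPlay P L s) := by
        refine integral_mono ?_ ?_ fun z => ?_
        · refine integrable_of_abs_le (B := Real.exp |-t| * Real.exp ((-t) ^ 2 / 2)) hm fun z => ?_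
          rw [abs_of_nonneg (integral_nonneg fun y => Real.exp_nonneg _)]
          exact integral_exp_loss_le_const P i z.1 z.2 (-t)
        · exact (integrable_of_abs_le (hbm.comp measurable_fst) fun z => hbb z.1).mul_const _
        · refine (P.integral_exp_loss_le i z.1 z.2 (-t)).trans ?_
          rw [neg_sq]
          refine mul_le_mul_of_nonneg_right (Real.exp_le_exp.2 ?_) (Real.exp_nonneg _)
          have := P.best_le_mean hi z.1 z.2
          nlinarith
    _ = (∫ x, Real.exp (-t * (P.best x - P.value)) ∂P.context) * Real.exp (t ^ 2 / 2) := by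
        rw [integral_mul_const, integral_soloPlay_fst P L hbm hbb]
    -- One factor pays for the fluctuation of the best value with the context, the other for the
    -- noise.
    _ ≤ Real.exp ((-t) ^ 2 / 2) * Real.exp (t ^ 2 / 2) :=
        mul_le_mul_of_nonneg_right (P.integral_exp_best_le (-t)) (Real.exp_nonneg _)
    _ = Real.exp (t ^ 2) := by rw [← Real.exp_add]; ring_nf

lemma abs_le_exp_add_exp (x : ℝ) : |x| ≤ Real.exp (1 * x) + Real.exp (-1 * x) := by
  have h1 := Real.add_one_le_exp (1 * x)
  have h2 := Real.add_one_le_exp (-1 * x)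
  exact abs_le.2 ⟨by linarith [Real.exp_pos (1 * x)], by linarith [Real.exp_pos (-1 * x)]⟩

lemma sq_le_exp_add_exp (x : ℝ) : x ^ 2 ≤ 2 * (Real.exp (1 * x) + Real.exp (-1 * x)) := by
  have h : x ^ 2 / 2 ≤ Real.exp |x| := by
    simpa using Real.pow_div_factorial_le_exp |x| (abs_nonneg x) 2
  have h1 := Real.exp_pos x
  have h2 := Real.exp_pos (-x)
  simp only [one_mul, neg_mul]
  rcases abs_choice x with h' | h' <;> rw [h'] at h <;> linarith

lemma integrable_sub_value_soloRound (s : L.State) :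
    Integrable (fun z => z.2 - P.value) (soloRound P i L s) := by
  refine ((integrable_exp_soloRound P i L s 1).add (integrable_exp_soloRound P i L s (-1))).mono'
    (by fun_prop) (.of_forall fun z => ?_)
  exact abs_le_exp_add_exp _

lemma integrable_sq_soloRound (s : L.State) :
    Integrable (fun z => (z.2 - P.value) ^ 2) (soloRound P i L s) := by
  refine (((integrable_exp_soloRound P i L s 1).add
    (integrable_exp_soloRound P i L s (-1))).const_mul 2).mono' (by fun_prop)
    (.of_forall fun z => ?_)
  rw [Real.norm_eq_abs, abs_of_nonneg (sq_nonneg (z.2 - P.value))]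
  exact sq_le_exp_add_exp _

lemma integral_sq_soloRound_le (s : L.State) :
    ∫ z, (z.2 - P.value) ^ 2 ∂(soloRound P i L s) ≤ 20 := by
  have h1 := integral_exp_soloRound_le P i L s 1
  have h2 := integral_exp_soloRound_le P i L s (-1)
  -- The constant 20 is `2 * (5 + 5)`: two exponential moments, each at most `e ^ (3 / 2) ≤ 5`.
  have hb : Real.exp |(1 : ℝ)| * Real.exp ((1 : ℝ) ^ 2 / 2) ≤ 5 := by
    rw [← Real.exp_add]
    have : Real.exp (|(1 : ℝ)| + 1 ^ 2 / 2) ^ 2 = Real.exp 1 ^ 3 := by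
      rw [← Real.exp_nat_mul, ← Real.exp_nat_mul]; norm_num
    have h3 : Real.exp 1 ^ 3 ≤ 2.7182818286 ^ 3 := by
      gcongr; exact Real.exp_one_lt_d9.le
    refine le_of_sq_le_sq (by rw [this]; exact h3.trans (by norm_num)) (by norm_num)
  calc _ ≤ ∫ z, 2 * (Real.exp (1 * (z.2 - P.value)) + Real.exp (-1 * (z.2 - P.value)))
        ∂(soloRound P i L s) :=
        integral_mono (integrable_sq_soloRound P i L s)
          (((integrable_exp_soloRound P i L s 1).add
            (integrable_exp_soloRound P i L s (-1))).const_mul 2)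
          fun z => sq_le_exp_add_exp _
    _ ≤ 20 := by
        rw [integral_const_mul, integral_add (integrable_exp_soloRound P i L s 1)
          (integrable_exp_soloRound P i L s (-1))]
        rw [abs_neg, neg_sq] at h2
        linarith

/-- The law of the context does not depend on the state, so `best` and its mean `value` are
interchangeable in expectation. Hence losses can be compared with one number although the strategy
never sees contexts. -/
lemma integral_sub_value_soloRound (s : L.State) :
    ∫ z, (z.2 - P.value) ∂(soloRound P i L s) = roundRegret P i L s := by
  rw [integral_soloRound P i L (integrable_sub_value_soloRound P i L s)]
  have h1 : ∀ z : X × A, ∫ y, (y - P.value) ∂(P.loss (i, z)) = P.mean i z.1 z.2 - P.value := by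
    intro z
    rw [integral_sub (f := fun y : ℝ => y) (P.integrable_loss i z.1 z.2) (integrable_const _)]
    simp [Problem.mean]
  simp only [h1]
  have hm : Integrable (fun z : X × A => P.mean i z.1 z.2) (soloPlay P L s) :=
    integrable_of_abs_le (B := 1) (P.measurable_mean_right i) fun z =>
      abs_le.2 ⟨by linarith [(P.mean_mem_Icc i z.1 z.2).1], (P.mean_mem_Icc i z.1 z.2).2⟩
  have hb : Integrable (fun z : X × A => P.best z.1) (soloPlay P L s) :=
    integrable_of_abs_le (P.measurable_best'.comp measurable_fst) fun z => P.abs_best_le z.1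
  rw [roundRegret, integral_sub hm (integrable_const _), integral_sub hm hb,
    integral_soloPlay_fst P L P.measurable_best' P.abs_best_le]
  simp [Problem.value]

end Solo

/-! ### Integrals over composed kernels with deterministic factors. -/

lemma integral_compProd_of_abs_le {α β γ : Type*} [MeasurableSpace α] [MeasurableSpace β]
    [MeasurableSpace γ] (κ : Kernel α β) (η : Kernel (α × β) γ) [IsMarkovKernel κ]
    [IsMarkovKernel η] (a : α) (f : β × γ → ℝ) (hf : Measurable f) {B : ℝ} (hB : ∀ z, |f z| ≤ B) :
    ∫ z, f z ∂((κ ⊗ₖ η) a) = ∫ b, ∫ c, f (b, c) ∂(η (a, b)) ∂(κ a) :=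
  integral_compProd (integrable_of_abs_le hf hB)

lemma integral_compProd_dirac {α β γ : Type*} [MeasurableSpace α] [MeasurableSpace β]
    [MeasurableSpace γ] (κ : Kernel α β) (η : Kernel (α × β) γ) [IsMarkovKernel κ]
    [IsMarkovKernel η] (a : α) (g : β → γ) (hg : ∀ b, η (a, b) = Measure.dirac (g b))
    (f : β × γ → ℝ) (hf : Measurable f) {B : ℝ} (hB : ∀ z, |f z| ≤ B) :
    ∫ z, f z ∂((κ ⊗ₖ η) a) = ∫ b, f (b, g b) ∂(κ a) := by
  rw [integral_compProd_of_abs_le κ η a f hf hB]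
  refine integral_congr_ae (.of_forall fun b => ?_)
  simp only [hg]
  exact integral_dirac' _ _ (hf.comp measurable_prodMk_left).stronglyMeasurable

/-- A product of Dirac measures and one arbitrary factor. -/
lemma pi_eq_map_update {ι : Type*} [Fintype ι] [DecidableEq ι] {β : ι → Type*}
    [∀ i, MeasurableSpace (β i)] (μ : ∀ i, Measure (β i)) [∀ i, IsProbabilityMeasure (μ i)]
    (s : ∀ i, β i) (i : ι) (h : ∀ j, j ≠ i → μ j = Measure.dirac (s j)) :
    Measure.pi μ = (μ i).map (Function.update s i) := by
  refine Measure.pi_eq fun t ht => ?_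
  rw [Measure.map_apply (measurable_update s) (MeasurableSet.univ_pi ht),
    ← Finset.mul_prod_erase Finset.univ _ (Finset.mem_univ i)]
  by_cases hs : ∀ j, j ≠ i → s j ∈ t j
  · have h1 : Function.update s i ⁻¹' Set.univ.pi t = t i := by
      ext x
      simp only [Set.mem_preimage, Set.mem_univ_pi]
      refine ⟨fun hx => by simpa using hx i, fun hx j => ?_⟩
      rcases eq_or_ne j i with rfl | hj
      · simpa using hx
      · simpa [hj] using hs j hj
    rw [h1, Finset.prod_eq_one, mul_one]
    intro j hj
    have hj := Finset.ne_of_mem_erase hj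
    rw [h j hj, Measure.dirac_apply' _ (ht j)]
    simp [hs j hj]
  · push Not at hs
    obtain ⟨j, hj, hjt⟩ := hs
    have h1 : Function.update s i ⁻¹' Set.univ.pi t = ∅ := by
      ext x
      simp only [Set.mem_preimage, Set.mem_univ_pi, Set.mem_empty_iff_false, iff_false, not_forall]
      exact ⟨j, by simpa [hj] using hjt⟩
    rw [h1, measure_empty, Finset.prod_eq_zero (i := j), mul_zero]
    · simp [hj]
    · rw [h j hj, Measure.dirac_apply' _ (ht j)]
      simp [hjt]

/-! ### Block rules and their messages. -/

/-- A deterministic corralling strategy that plays the base learners in blocks. The selected base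
learner receives the observed losses; when a block stops, all base learners are restarted. -/
structure BlockRule (K : ℕ) (State : Type) [MeasurableSpace State] where
  start : State
  select : State → Fin K
  measurable_select : Measurable select
  next : State × ℝ → State
  measurable_next : Measurable next
  restarts : Set (State × ℝ)
  measurableSet_restarts : MeasurableSet restarts

namespace BlockRule

variable {K : ℕ} {State : Type} [MeasurableSpace State] (R : BlockRule K State)

open Classical in
/-- The messages of the strategy when the learner `i` has been played and the loss is `y`. -/
def message (p : State × Fin K × ℝ) (i : Fin K) : Message :=
  if (p.1, p.2.2) ∈ R.restarts then (Command.restart, 0)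
  else if i = p.2.1 then (Command.feedback, p.2.2) else (Command.skip, 0)

lemma measurable_message : Measurable R.message := by
  classical
  refine measurable_pi_lambda _ fun i => ?_
  refine Measurable.ite ?_ measurable_const (Measurable.ite ?_ ?_ measurable_const)
  · exact R.measurableSet_restarts.preimage (by fun_prop)
  · exact measurableSet_eq_fun measurable_const (by fun_prop)
  · fun_prop

/-- The update function of the strategy. -/
def transition (p : State × Fin K × ℝ) : State × (Fin K → Message) :=
  (R.next (p.1, p.2.2), R.message p)

lemma measurable_transition : Measurable R.transition :=
  (R.measurable_next.comp (by fun_prop)).prodMk R.measurable_message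

end BlockRule

/-! ### Reduction of a corralled round to a solo round. -/

section Corral

variable {X : Type u} {A : Type v} [MeasurableSpace X] [MeasurableSpace A] {K : ℕ} {d : Fin K → ℕ}
  (P : Problem X A d) (L : Fin K → BaseLearner.{u, v, w} X A)

section

variable (S : Strategy K)

instance : IsMarkovKernel (corralProposals P L S) := by unfold corralProposals; infer_instance
instance : IsMarkovKernel (corralPlay P L S) := by unfold corralPlay; infer_instance
instance : IsMarkovKernel (corralRound P L S) := by unfold corralRound; infer_instance
instance : IsMarkovKernel (corralMessages P L S) := by unfold corralMessages; infer_instance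
instance : IsMarkovKernel (corralStep P L S) := by
  unfold corralStep
  exact Kernel.IsMarkovKernel.map _ (by fun_prop)

end

variable {State : Type} [MeasurableSpace State] (R : BlockRule K State)

/-- The joint law of the initial states of the base learners. -/
abbrev initLaw : Measure (∀ i, (L i).State) := Measure.pi fun i => (L i).init

open Classical in
/-- The expectation of `f`, evaluated at the joint state after a round with the outcome `z`. -/
def afterRound (f : (∀ i, (L i).State) × State → ℝ) (s : ∀ i, (L i).State) (σ : State)
    (z : (X × A) × ℝ) : ℝ :=
  if (σ, z.2) ∈ R.restarts then ∫ s', f (s', R.next (σ, z.2)) ∂(initLaw L)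
  else ∫ s', f (Function.update s (R.select σ) s', R.next (σ, z.2))
    ∂((L (R.select σ)).update (s (R.select σ), z.1, z.2))

variable {f : (∀ i, (L i).State) × State → ℝ} (hf : Measurable f)
include hf

lemma measurable_afterRound (s : ∀ i, (L i).State) (σ : State) :
    Measurable (afterRound L R f s σ) := by
  classical
  have hn : Measurable fun z : (X × A) × ℝ => R.next (σ, z.2) :=
    R.measurable_next.comp (by fun_prop)
  refine Measurable.ite (R.measurableSet_restarts.preimage (by fun_prop)) ?_ ?_
  · have h : Measurable fun p : ((X × A) × ℝ) × (∀ i, (L i).State) =>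
        f (p.2, R.next (σ, p.1.2)) :=
      hf.comp (measurable_snd.prodMk (hn.comp measurable_fst))
    exact (h.stronglyMeasurable.integral_prod_right' (ν := initLaw L)).measurable
  · have h : Measurable fun p : ((X × A) × ℝ) × (L (R.select σ)).State =>
        f (Function.update s (R.select σ) p.2, R.next (σ, p.1.2)) :=
      hf.comp (((measurable_update s).comp measurable_snd).prodMk (hn.comp measurable_fst))
    have hu : Measurable fun z : (X × A) × ℝ => (s (R.select σ), z.1, z.2) := by fun_prop
    exact (h.stronglyMeasurable.integral_kernel_prod_right'
      (κ := (L (R.select σ)).update.comap _ hu)).measurable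

omit hf in
lemma abs_afterRound_le {B : ℝ} (hB : ∀ z, |f z| ≤ B) (s : ∀ i, (L i).State) (σ : State)
    (z : (X × A) × ℝ) : |afterRound L R f s σ z| ≤ B := by
  unfold afterRound
  split_ifs
  · exact abs_integral_le_of_abs_le fun _ => hB _
  · exact abs_integral_le_of_abs_le fun _ => hB _

/-- Without a restart all learners but the selected one have Dirac reactions, so the product law is
carried by one updated coordinate. A restart turns it into the joint initial law. -/
lemma integral_respond (s : ∀ i, (L i).State) (σ : State) (x : X) (as : Fin K → A) (y : ℝ) :
    ∫ s', f (s', (R.transition (σ, R.select σ, y)).1)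
      ∂(Measure.pi fun i => respond (L i)
        ((s i, (x, as i)), (R.transition (σ, R.select σ, y)).2 i)) =
      afterRound L R f s σ ((x, as (R.select σ)), y) := by
  unfold afterRound
  by_cases h : (σ, y) ∈ R.restarts
  · rw [if_pos h]
    have : (fun i => respond (L i) ((s i, (x, as i)), (R.transition (σ, R.select σ, y)).2 i)) =
        fun i => (L i).init := by
      funext i
      simp only [BlockRule.transition, BlockRule.message, if_pos h]
      rfl
    rw [this]
    rfl
  · rw [if_neg h, pi_eq_map_update _ s (R.select σ), integral_map]
    · have : respond (L (R.select σ)) ((s (R.select σ), (x, as (R.select σ))),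
          (R.transition (σ, R.select σ, y)).2 (R.select σ)) =
          (L (R.select σ)).update (s (R.select σ), (x, as (R.select σ)), y) := by
        simp only [BlockRule.transition, BlockRule.message, if_neg h, if_true]
        rfl
      rw [this]
      rfl
    · exact (measurable_update s).aemeasurable
    · exact (hf.comp (measurable_id.prodMk measurable_const)).aestronglyMeasurable
    · intro j hj
      simp only [BlockRule.transition, BlockRule.message, if_neg h, if_neg hj]
      rfl

omit hf in
-- Given the context the proposals are independent, so the marginal at `i` is the solo play of
-- learner `i`.
lemma integral_corralProposals (S : Strategy K) (z : JointState L S) (i : Fin K) {f : X × A → ℝ}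
    (hf : Measurable f) {B : ℝ} (hB : ∀ z, |f z| ≤ B) :
    ∫ q, f (q.1, q.2 i) ∂(corralProposals P L S z) = ∫ q, f q ∂(soloPlay P (L i) (z.1 i)) := by
  rw [integral_soloPlay P (L i) hf hB]
  unfold corralProposals
  rw [integral_compProd_of_abs_le _ _ _ (fun q : X × (Fin K → A) => f (q.1, q.2 i))
    (hf.comp (by fun_prop)) fun q => hB _]
  simp only [Kernel.const_apply]
  refine integral_congr_ae (.of_forall fun x => ?_)
  have h := (measurePreserving_eval (fun i => (L i).act (z.1 i, x)) i)
  change ∫ as, f (x, as i) ∂(Measure.pi fun i => (L i).act (z.1 i, x)) = _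
  change _ = ∫ a, f (x, a) ∂((L i).act (z.1 i, x))
  rw [← h.map_eq]
  have hfx : Measurable fun a => f (x, a) := hf.comp measurable_prodMk_left
  exact (integral_map (φ := fun as : Fin K → A => as i) (measurable_pi_apply i).aemeasurable
    hfx.aestronglyMeasurable).symm

end Corral

section Corral

variable {X : Type u} {A : Type v} [MeasurableSpace X] [MeasurableSpace A] {K : ℕ} {d : Fin K → ℕ}
  (P : Problem X A d) (L : Fin K → BaseLearner.{u, v, w} X A)
  {S : Strategy K} (R : BlockRule K S.State)
  (hsel : ∀ σ, S.select σ = Measure.dirac (R.select σ))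
  (hupd : ∀ p, S.update p = Measure.dirac (R.transition p))

include hsel in
lemma integral_corralPlay (z : JointState L S) (F : (X × (Fin K → A)) × Fin K → ℝ)
    (hF : Measurable F) {B : ℝ} (hB : ∀ q, |F q| ≤ B) :
    ∫ q, F q ∂(corralPlay P L S z) =
      ∫ q, F (q, R.select z.2) ∂(corralProposals P L S z) :=
  integral_compProd_dirac _ _ _ (fun _ => R.select z.2)
    (fun _ => hsel _) F hF hB

include hsel in
lemma integral_corralRound (z : JointState L S)
    (F : ((X × (Fin K → A)) × Fin K) × ℝ → ℝ) (hF : Measurable F) {B : ℝ} (hB : ∀ q, |F q| ≤ B) :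
    ∫ q, F q ∂(corralRound P L S z) =
      ∫ q, ∫ y, F ((q, R.select z.2), y) ∂(P.loss (R.select z.2, q.1, q.2 (R.select z.2)))
        ∂(corralProposals P L S z) := by
  have h : Measurable fun v : (X × (Fin K → A)) × Fin K =>
      ∫ y, F (v, y) ∂(P.loss (v.2, v.1.1, v.1.2 v.2)) :=
    (hF.stronglyMeasurable.integral_kernel_prod_right'
      (κ := P.loss.comap _ measurable_played)).measurable
  refine Eq.trans (integral_compProd_of_abs_le _ _ _ F hF hB) ?_
  exact integral_corralPlay P L R hsel z _ h fun _ => abs_integral_le_of_abs_le fun _ => hB _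

include hsel hupd in
lemma integral_corralMessages (z : JointState L S)
    (F : (((X × (Fin K → A)) × Fin K) × ℝ) × (S.State × (Fin K → Message)) → ℝ)
    (hF : Measurable F) {B : ℝ} (hB : ∀ q, |F q| ≤ B) :
    ∫ q, F q ∂(corralMessages P L S z) =
      ∫ q, ∫ y, F (((q, R.select z.2), y), R.transition (z.2, R.select z.2, y))
        ∂(P.loss (R.select z.2, q.1, q.2 (R.select z.2))) ∂(corralProposals P L S z) := by
  have ht : Measurable fun q : ((X × (Fin K → A)) × Fin K) × ℝ =>
      (q, R.transition (z.2, q.1.2, q.2)) :=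
    measurable_id.prodMk (R.measurable_transition.comp
      (measurable_const.prodMk (measurable_fst.snd.prodMk measurable_snd)))
  have h1 : ∫ q, F q ∂(corralMessages P L S z) =
      ∫ q, F (q, R.transition (z.2, q.1.2, q.2)) ∂(corralRound P L S z) := by
    have hc : Measurable fun p : JointState L S × (((X × (Fin K → A)) × Fin K) × ℝ) =>
        (p.1.2, p.2.1.2, p.2.2) := by fun_prop
    have hq : ∀ q, S.update.comap _ hc (z, q) =
        Measure.dirac (R.transition (z.2, q.1.2, q.2)) := fun q => by
      rw [Kernel.comap_apply, hupd]
    exact integral_compProd_dirac (corralRound P L S) (S.update.comap _ hc) z _ hq F hF hB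
  rw [h1]
  exact integral_corralRound P L R hsel z (fun q => F (q, R.transition (z.2, q.1.2, q.2)))
    (hF.comp ht) fun _ => hB _

include hsel hupd in
/-- The expectation over one round of corralling with a block rule. -/
lemma integral_corralStep {f : JointState L S → ℝ} (hf : Measurable f) {B : ℝ}
    (hB : ∀ z, |f z| ≤ B) (s : ∀ i, (L i).State) (σ : S.State) :
    ∫ z, f z ∂(corralStep P L S (s, σ)) =
      ∫ z, afterRound L R f s σ z
        ∂(soloRound P (R.select σ) (L (R.select σ)) (s (R.select σ))) := by
  have hG := measurable_afterRound (X := X) L R hf s σ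
  have hGB := abs_afterRound_le (X := X) L R hB s σ
  have hm : Measurable fun m : (((X × (Fin K → A)) × Fin K) × ℝ) ×
      (S.State × (Fin K → Message)) =>
      ∫ s', f (s', m.2.1) ∂(Measure.pi fun i => respond (L i)
        ((s i, (m.1.1.1.1, m.1.1.1.2 i)), m.2.2 i)) := by
    have h : Measurable fun q : ((((X × (Fin K → A)) × Fin K) × ℝ) ×
      (S.State × (Fin K → Message))) × (∀ i, (L i).State) => f (q.2, q.1.2.1) :=
      hf.comp (by fun_prop)
    have hr : ∀ i, Measurable fun m : (((X × (Fin K → A)) × Fin K) × ℝ) ×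
      (S.State × (Fin K → Message)) => ((s i, (m.1.1.1.1, m.1.1.1.2 i)), m.2.2 i) := by
      intro i; fun_prop
    exact (h.stronglyMeasurable.integral_kernel_prod_right'
      (κ := piKernel fun i => (respond (L i)).comap _ (hr i))).measurable
  have hH : Measurable fun z : X × A =>
      ∫ y, afterRound L R f s σ (z, y) ∂(P.loss (R.select σ, z)) :=
    (hG.stronglyMeasurable.integral_kernel_prod_right'
      (κ := P.loss.comap (fun z : X × A => (R.select σ, z)) (by fun_prop))).measurable
  unfold corralStep
  rw [Kernel.map_apply _ (by fun_prop), integral_map (by fun_prop) hf.aestronglyMeasurable]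
  refine Eq.trans (integral_compProd_of_abs_le _ _ _ (fun q : ((((X × (Fin K → A)) × Fin K) × ℝ) ×
    (S.State × (Fin K → Message))) × (∀ i, (L i).State) => f (q.2, q.1.2.1))
    (hf.comp (by fun_prop)) fun q => hB _) ?_
  refine Eq.trans (integral_corralMessages P L R hsel hupd (s, σ) _ hm
    fun _ => abs_integral_le_of_abs_le fun _ => hB _) ?_
  rw [integral_soloRound P _ _ (integrable_of_abs_le hG hGB),
    ← integral_corralProposals P L S (s, σ) (R.select σ) hH
      fun _ => abs_integral_le_of_abs_le fun w => hGB _]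
  refine integral_congr_ae (.of_forall fun q => ?_)
  refine integral_congr_ae (.of_forall fun y => ?_)
  exact integral_respond L R hf s σ q.1 q.2 y

/-- The expected regret over `r` rounds of corralling with a block rule. -/
def blockValue {State : Type} [MeasurableSpace State] (R : BlockRule K State) :
    ℕ → (∀ i, (L i).State) × State → ℝ
  | 0 => fun _ => 0
  | r + 1 => fun z =>
      roundRegret P (R.select z.2) (L (R.select z.2)) (z.1 (R.select z.2)) +
        ∫ q, afterRound L R (blockValue R r) z.1 z.2 q
          ∂(soloRound P (R.select z.2) (L (R.select z.2)) (z.1 (R.select z.2)))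

include hsel in
lemma integral_regret_corralPlay (z : JointState L S) :
    ∫ q, (P.mean q.2 q.1.1 (q.1.2 q.2) - P.best q.1.1) ∂(corralPlay P L S z) =
      roundRegret P (R.select z.2) (L (R.select z.2)) (z.1 (R.select z.2)) := by
  rw [integral_corralPlay P L R hsel z
    (fun q => P.mean q.2 q.1.1 (q.1.2 q.2) - P.best q.1.1)
    ((P.measurable_mean.comp measurable_played).sub (P.measurable_best'.comp (by fun_prop)))
    fun _ => P.abs_mean_sub_best_le _ _ _]
  exact integral_corralProposals P L S z (R.select z.2)
    (measurable_mean_sub_best P (R.select z.2)) fun _ => P.abs_mean_sub_best_le _ _ _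

include hsel hupd in
lemma blockValue_eq_costToGo (r : ℕ) : blockValue P L R r =
    costToGo (fun z => ∫ q, (P.mean q.2 q.1.1 (q.1.2 q.2) - P.best q.1.1) ∂(corralPlay P L S z))
      (corralStep P L S) r := by
  have hg : Measurable fun z : JointState L S =>
      ∫ q, (P.mean q.2 q.1.1 (q.1.2 q.2) - P.best q.1.1) ∂(corralPlay P L S z) :=
    measurable_integral_kernel _
      ((P.measurable_mean.comp measurable_played).sub (P.measurable_best'.comp (by fun_prop)))
  have hB : ∀ z : JointState L S,
      |∫ q, (P.mean q.2 q.1.1 (q.1.2 q.2) - P.best q.1.1) ∂(corralPlay P L S z)| ≤ 1 :=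
    fun z => abs_integral_le_of_abs_le fun _ => P.abs_mean_sub_best_le _ _ _
  induction r with
  | zero => rfl
  | succ r ih =>
    funext ⟨s, σ⟩
    simp only [blockValue, costToGo]
    rw [integral_corralStep P L R hsel hupd (measurable_costToGo hg r) (abs_costToGo_le hB r),
      ih, integral_regret_corralPlay P L R hsel]

include hsel hupd in
lemma measurable_blockValue' (r : ℕ) : Measurable (blockValue P L R r) := by
  rw [blockValue_eq_costToGo P L R hsel hupd]
  exact measurable_costToGo (measurable_integral_kernel _
    ((P.measurable_mean.comp measurable_played).sub (P.measurable_best'.comp (by fun_prop)))) r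

include hsel hupd in
lemma corralRegret_eq (hinit : S.init = Measure.dirac R.start) (T : ℕ) :
    corralRegret P L S T = ∫ s, blockValue P L R T (s, R.start) ∂(initLaw L) := by
  have hgm : Measurable fun q : (X × (Fin K → A)) × Fin K =>
      P.mean q.2 q.1.1 (q.1.2 q.2) - P.best q.1.1 :=
    (P.measurable_mean.comp measurable_played).sub (P.measurable_best'.comp (by fun_prop))
  have hgB : ∀ q : (X × (Fin K → A)) × Fin K,
      |P.mean q.2 q.1.1 (q.1.2 q.2) - P.best q.1.1| ≤ 1 := fun _ => P.abs_mean_sub_best_le _ _ _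
  have hprob : ∀ t, IsProbabilityMeasure (corralLaw P L S t) := by
    intro t
    induction t with
    | zero => unfold corralLaw; infer_instance
    | succ t ih => unfold corralLaw; infer_instance
  have := hprob 0
  have h := sum_integral_eq_integral_costToGo (measurable_integral_kernel (corralPlay P L S) hgm)
    (fun z => abs_integral_le_of_abs_le hgB) (corralLaw P L S) (fun _ => rfl) T
  rw [← blockValue_eq_costToGo P L R hsel hupd] at h
  have h0 : ∫ z, blockValue P L R T z ∂(corralLaw P L S 0) =
      ∫ s, blockValue P L R T (s, R.start) ∂(initLaw L) := by
    change ∫ z, blockValue P L R T z ∂((initLaw L).prod S.init) = _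
    rw [hinit, Measure.prod_dirac, integral_map (by fun_prop)
      (measurable_blockValue' P L R hsel hupd T).aestronglyMeasurable]
  rw [← h0, ← h]
  refine Finset.sum_congr rfl fun t _ => ?_
  have := hprob t
  exact Measure.integral_compProd
    (integrable_of_abs_le (hgm.comp measurable_snd) fun _ => hgB _)

end Corral

namespace BlockRule

variable {K : ℕ} {State : Type} [m : MeasurableSpace State] (R : BlockRule K State)

/-- The corralling strategy of a block rule. -/
def strategy : Strategy K where
  State := State
  measurableSpace := m
  init := Measure.dirac R.start
  isProbabilityMeasure_init := inferInstance
  select := Kernel.deterministic R.select R.measurable_select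
  isMarkovKernel_select := inferInstance
  update := Kernel.deterministic R.transition R.measurable_transition
  isMarkovKernel_update := inferInstance

end BlockRule

/-! ### Regret from a fresh start, and its one-round recursion. -/

section Value

variable {X : Type u} {A : Type v} [MeasurableSpace X] [MeasurableSpace A] {K : ℕ} {d : Fin K → ℕ}
  (P : Problem X A d) (L : Fin K → BaseLearner.{u, v, w} X A)
  {State : Type} [MeasurableSpace State] (R : BlockRule K State)

lemma measurable_blockValue (r : ℕ) : Measurable (blockValue P L R r) :=
  measurable_blockValue' P L (S := R.strategy) R
    (fun _ => Kernel.deterministic_apply R.measurable_select _)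
    (fun _ => Kernel.deterministic_apply R.measurable_transition _) r

lemma abs_blockValue_le (r : ℕ) (z : (∀ i, (L i).State) × State) : |blockValue P L R r z| ≤ r := by
  induction r generalizing z with
  | zero => simp [blockValue]
  | succ r ih =>
    simp only [blockValue]
    refine (abs_add_le _ _).trans ?_
    push_cast
    linarith [abs_roundRegret_le P (R.select z.2) (L (R.select z.2)) (z.1 (R.select z.2)),
      abs_integral_le_of_abs_le (μ := soloRound P (R.select z.2) (L (R.select z.2))
        (z.1 (R.select z.2))) (abs_afterRound_le (X := X) L R ih z.1 z.2)]

/-- The expected regret over `r` rounds from the state `σ` on, when all learners start anew. -/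
def restartValue (r : ℕ) (σ : State) : ℝ := ∫ s, blockValue P L R r (s, σ) ∂(initLaw L)

lemma restartValue_le (r : ℕ) (σ : State) : restartValue P L R r σ ≤ r :=
  (abs_le.1 (abs_integral_le_of_abs_le fun _ => abs_blockValue_le P L R r _)).2

lemma restartValue_zero (σ : State) : restartValue P L R 0 σ = 0 := by
  simp [restartValue, blockValue]

lemma corralRegret_strategy (T : ℕ) :
    corralRegret P L R.strategy T = restartValue P L R T R.start :=
  corralRegret_eq P L (S := R.strategy) R
    (fun _ => Kernel.deterministic_apply R.measurable_select _)
    (fun _ => Kernel.deterministic_apply R.measurable_transition _) rfl T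

/-- The dominating function sees only the learner of the block, so the joint initial law collapses
to one factor, on which the solo regret is an integral. -/
lemma restartValue_le_integral (r : ℕ) (σ : State) (i : Fin K) {g : (L i).State → ℝ}
    (hg : Integrable g (L i).init) (h : ∀ s, blockValue P L R r (s, σ) ≤ g (s i)) :
    restartValue P L R r σ ≤ ∫ s, g s ∂(L i).init := by
  have hp := measurePreserving_eval (fun i => (L i).init) i
  rw [← hp.map_eq] at hg ⊢
  rw [integral_map hp.measurable.aemeasurable hg.1]
  refine integral_mono ?_ (hg.comp_measurable hp.measurable) h
  exact integrable_of_abs_le ((measurable_blockValue P L R r).comp (by fun_prop))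
    fun s => abs_blockValue_le P L R r _

lemma integral_soloStep (i : Fin K) (s : (L i).State) {f : (L i).State → ℝ} (hf : Measurable f)
    {B : ℝ} (hB : ∀ s, |f s| ≤ B) :
    ∫ s', f s' ∂(soloStep P i (L i) s) =
      ∫ z, ∫ s', f s' ∂((L i).update (s, z.1, z.2)) ∂(soloRound P i (L i) s) := by
  unfold soloStep
  rw [Kernel.snd_apply, integral_map (by fun_prop) hf.aestronglyMeasurable]
  exact integral_compProd_of_abs_le _ _ _ (fun z => f z.2) (hf.comp measurable_snd) fun _ => hB _

/-- One round within a block, in terms of a bound on the regret of the later rounds. -/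
lemma blockValue_succ_le (r m : ℕ) (s : ∀ i, (L i).State) (σ : State) {i : Fin K}
    (hi : R.select σ = i) {a : ℝ} {h : ℝ → ℝ}
    (ha : ∀ s', 0 ≤ a * regretToGo P i (L i) m s')
    (hint : Integrable (fun z => h z.2) (soloRound P i (L i) (s i)))
    (hnew : ∀ y, (σ, y) ∈ R.restarts → restartValue P L R r (R.next (σ, y)) ≤ h y)
    (hcont : ∀ y, (σ, y) ∉ R.restarts → ∀ s' : ∀ i, (L i).State,
      blockValue P L R r (s', R.next (σ, y)) ≤ a * regretToGo P i (L i) m (s' i) + h y) :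
    blockValue P L R (r + 1) (s, σ) ≤ roundRegret P i (L i) (s i) +
      a * ∫ s', regretToGo P i (L i) m s' ∂(soloStep P i (L i) (s i)) +
      ∫ z, h z.2 ∂(soloRound P i (L i) (s i)) := by
  subst hi
  have hρ := measurable_regretToGo P (R.select σ) (L (R.select σ)) m
  have hρB := abs_regretToGo_le P (R.select σ) (L (R.select σ)) m
  have hV := measurable_blockValue P L R r
  have hVB := abs_blockValue_le P L R r
  have hu : Measurable fun z : (X × A) × ℝ => (s (R.select σ), z.1, z.2) := by fun_prop
  have hU : Measurable fun z : (X × A) × ℝ => ∫ s', regretToGo P (R.select σ) (L (R.select σ)) m s'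
      ∂((L (R.select σ)).update (s (R.select σ), z.1, z.2)) :=
    measurable_integral_kernel ((L (R.select σ)).update.comap _ hu) hρ
  have hUi : Integrable (fun z : (X × A) × ℝ =>
      a * ∫ s', regretToGo P (R.select σ) (L (R.select σ)) m s'
      ∂((L (R.select σ)).update (s (R.select σ), z.1, z.2)))
      (soloRound P (R.select σ) (L (R.select σ)) (s (R.select σ))) :=
    (integrable_of_abs_le hU fun z => abs_integral_le_of_abs_le hρB).const_mul a
  have key : ∀ z, afterRound L R (blockValue P L R r) s σ z ≤
      a * (∫ s', regretToGo P (R.select σ) (L (R.select σ)) m s'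
      ∂((L (R.select σ)).update (s (R.select σ), z.1, z.2))) + h z.2 := by
    intro z
    unfold afterRound
    split_ifs with hz
    -- The block has stopped, so the solo regret of its remaining rounds is not incurred; being
    -- non-negative after scaling, it may stay in the bound.
    · rw [← integral_const_mul]
      have := integral_nonneg (f := fun s' => a * regretToGo P (R.select σ) (L (R.select σ)) m s')
        (μ := (L (R.select σ)).update (s (R.select σ), z.1, z.2)) ha
      linarith [hnew z.2 hz, show (∫ s', blockValue P L R r (s', R.next (σ, z.2)) ∂(initLaw L)) =
        restartValue P L R r (R.next (σ, z.2)) from rfl]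
    · have hi1 := (integrable_of_abs_le (μ := (L (R.select σ)).update (s (R.select σ), z.1, z.2))
        hρ hρB).const_mul a
      have h1 : ∫ s', (a * regretToGo P (R.select σ) (L (R.select σ)) m s' + h z.2)
          ∂((L (R.select σ)).update (s (R.select σ), z.1, z.2)) = _ :=
        integral_add hi1 (integrable_const _)
      rw [integral_const_mul, integral_const] at h1
      simp only [probReal_univ, one_smul] at h1
      rw [← h1]
      refine integral_mono ?_ (hi1.add (integrable_const _)) fun s' => ?_
      · exact integrable_of_abs_le
          (hV.comp ((measurable_update s).prodMk measurable_const)) fun _ => hVB _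
      · have := hcont z.2 hz (Function.update s (R.select σ) s')
        rwa [Function.update_self] at this
  have hA := measurable_afterRound (X := X) L R hV s σ
  have hAB := abs_afterRound_le (X := X) L R hVB s σ
  rw [integral_soloStep P L _ _ hρ hρB, ← integral_const_mul, add_assoc, ← integral_add hUi hint]
  simp only [blockValue]
  gcongr
  · exact integrable_of_abs_le hA hAB
  · exact hUi.add hint
  · exact key

end Value

/-! ### The explore-then-commit rule. -/

/-- The parameters of the explore-then-commit strategy. There is an arm for each `j : ℕ`, which is
represented by the base learner `rep j`. In phase `b`, the strategy plays `copies` blocks of length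
`len b j` of each arm `j = top, …, b + 1`, and then the arm `b`. It keeps an upper confidence bound
`W` of the optimal value; as soon as the losses of an arm `j` in a block exceed the bound by
`thr j`, the phase `j + 1` starts. -/
structure Config (K : ℕ) where
  copies : ℕ
  top : ℕ
  len : ℕ → ℕ → ℕ
  thr : ℕ → ℝ
  conf : ℝ
  rep : ℕ → Fin K
  first : ℕ

namespace Config

variable {K : ℕ} (c : Config K)

/-- The phase `b`, the number `q` of blocks that remain before the arm `b` is played, the number of
rounds in the current block, the sum of the losses in the block, and the bound `W`. -/
abbrev State : Type := ℕ × ℕ × ℕ × ℝ × ℝ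

/-- The arm that is played in phase `b` when `q` exploration blocks remain. -/
def arm (b q : ℕ) : ℕ := b + (q + c.copies - 1) / c.copies

/-- The state at the start of phase `b`. -/
def phaseStart (b : ℕ) : State := (b, c.copies * (c.top - b), 0, 0, 1)

/-- The bound after a block of length `N` with total loss `S`. -/
def newBound (N : ℕ) (S W : ℝ) : ℝ := min W (S / N + c.conf / √N)

/-- The losses in the block are too large. -/
def exceeds : Set (State × ℝ) :=
  {p | c.thr (c.arm p.1.1 p.1.2.1) < p.1.2.2.2.1 + p.2 - ((p.1.2.2.1 + 1 : ℕ) : ℝ) * p.1.2.2.2.2}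

/-- The block has full length. -/
def completes : Set (State × ℝ) :=
  {p | p.1.2.2.1 + 1 = c.len p.1.1 (c.arm p.1.1 p.1.2.1)}

open Classical in
/-- The state after a round. -/
def next (p : State × ℝ) : State :=
  if p ∈ c.exceeds then c.phaseStart (c.arm p.1.1 p.1.2.1 + 1)
  else if p ∈ c.completes then
    (p.1.1, p.1.2.1 - 1, 0, 0,
      c.newBound (c.len p.1.1 (c.arm p.1.1 p.1.2.1)) (p.1.2.2.2.1 + p.2) p.1.2.2.2.2)
  else (p.1.1, p.1.2.1, p.1.2.2.1 + 1, p.1.2.2.2.1 + p.2, p.1.2.2.2.2)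

lemma measurable_position : Measurable fun σ : State => (σ.1, σ.2.1) := by fun_prop

lemma measurable_arm : Measurable fun p : State × ℝ => c.arm p.1.1 p.1.2.1 :=
  (Measurable.of_discrete (f := fun q : ℕ × ℕ => c.arm q.1 q.2)).comp
    (measurable_position.comp measurable_fst)

lemma measurable_len : Measurable fun p : State × ℝ => c.len p.1.1 (c.arm p.1.1 p.1.2.1) :=
  (Measurable.of_discrete (f := fun q : ℕ × ℕ => c.len q.1 (c.arm q.1 q.2))).comp
    (measurable_position.comp measurable_fst)

lemma measurableSet_exceeds : MeasurableSet c.exceeds := by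
  have h1 : Measurable fun p : State × ℝ => c.thr (c.arm p.1.1 p.1.2.1) :=
    (Measurable.of_discrete (f := c.thr)).comp c.measurable_arm
  have h2 : Measurable fun p : State × ℝ => ((p.1.2.2.1 + 1 : ℕ) : ℝ) :=
    (Measurable.of_discrete (f := fun n : ℕ => ((n + 1 : ℕ) : ℝ))).comp (by fun_prop)
  exact measurableSet_lt h1 (by fun_prop)

lemma measurableSet_completes : MeasurableSet c.completes := by
  have h : Measurable fun p : State × ℝ => p.1.2.2.1 + 1 :=
    (Measurable.of_discrete (f := fun n : ℕ => n + 1)).comp (by fun_prop)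
  exact measurableSet_eq_fun h c.measurable_len

lemma measurable_next : Measurable c.next := by
  classical
  refine Measurable.ite c.measurableSet_exceeds ?_ (Measurable.ite c.measurableSet_completes ?_ ?_)
  · exact (Measurable.of_discrete (f := fun j : ℕ => c.phaseStart (j + 1))).comp c.measurable_arm
  · have h1 : Measurable fun p : State × ℝ => p.1.2.1 - 1 :=
      (Measurable.of_discrete (f := fun n : ℕ => n - 1)).comp (by fun_prop)
    have h2 : Measurable fun p : State × ℝ => (c.len p.1.1 (c.arm p.1.1 p.1.2.1) : ℝ) :=
      (Measurable.of_discrete (f := fun n : ℕ => (n : ℝ))).comp c.measurable_len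
    unfold newBound
    fun_prop
  · have h : Measurable fun p : State × ℝ => p.1.2.2.1 + 1 :=
      (Measurable.of_discrete (f := fun n : ℕ => n + 1)).comp (by fun_prop)
    fun_prop

/-- The strategy as a block rule. -/
def rule : BlockRule K State where
  start := c.phaseStart c.first
  select σ := c.rep (c.arm σ.1 σ.2.1)
  measurable_select :=
    (Measurable.of_discrete (f := fun q : ℕ × ℕ => c.rep (c.arm q.1 q.2))).comp
      measurable_position
  next := c.next
  measurable_next := c.measurable_next
  restarts := c.exceeds ∪ c.completes
  measurableSet_restarts := c.measurableSet_exceeds.union c.measurableSet_completes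

end Config

/-! ### Potential functions within one block. -/

section Blocks

variable {X : Type u} {A : Type v} [MeasurableSpace X] [MeasurableSpace A] {K : ℕ} {d : Fin K → ℕ}
  (P : Problem X A d) (L : Fin K → BaseLearner.{u, v, w} X A) (c : Config K)

lemma integrable_affine {Z : Type*} [MeasurableSpace Z] {μ : Measure Z} [IsFiniteMeasure μ]
    {f g h : Z → ℝ} (hf : Integrable f μ) (hg : Integrable g μ) (hh : Integrable h μ)
    (a b c e : ℝ) : Integrable (fun z => a + b * f z + c * g z + e * h z) μ :=
  (((integrable_const a).add (hf.const_mul b)).add (hg.const_mul c)).add (hh.const_mul e)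

lemma integral_affine {Z : Type*} [MeasurableSpace Z] {μ : Measure Z} [IsProbabilityMeasure μ]
    {f g h : Z → ℝ} (hf : Integrable f μ) (hg : Integrable g μ) (hh : Integrable h μ)
    (a b c e : ℝ) : ∫ z, (a + b * f z + c * g z + e * h z) ∂μ =
      a + b * ∫ z, f z ∂μ + c * ∫ z, g z ∂μ + e * ∫ z, h z ∂μ := by
  have h1 : Integrable (fun z => a + b * f z) μ := (integrable_const a).add (hf.const_mul b)
  have h2 : Integrable (fun z => a + b * f z + c * g z) μ := h1.add (hg.const_mul c)
  rw [integral_add h2 (hh.const_mul e), integral_add h1 (hg.const_mul c),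
    integral_add (integrable_const a) (hf.const_mul b), integral_const_mul, integral_const_mul,
    integral_const_mul]
  simp

/-- By `e ^ u ≥ 1 + u`. The exponential compensates negative values of the excess loss `x`, so
Markov's inequality can be applied to it. -/
lemma add_exp_div_nonneg {t x y : ℝ} (ht : 0 < t) (hy : 0 ≤ y) :
    0 ≤ x + Real.exp (-t * x + y) / t := by
  have h1 := Real.add_one_le_exp (-t * x + y)
  have h2 : (-t * x + y + 1) / t ≤ Real.exp (-t * x + y) / t := by gcongr
  have h3 : (-t * x + y + 1) / t = -x + (y + 1) / t := by field_simp; ring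
  have h4 : 0 ≤ (y + 1) / t := by positivity
  linarith

lemma exp_add_mul (t x u y : ℝ) :
    Real.exp (-t * (x + u) + y) = Real.exp (-t * x + y) * Real.exp (-t * u) := by
  rw [← Real.exp_add]; ring_nf

/-- The regret from a state within a block of a well-specified learner. The regret of the later
blocks is at most `c1` if the losses exceed the threshold. Otherwise it is at most `c0`, up to
additional terms `c2` if the losses in the block are large and `c3` if they are small. -/
lemma blockValue_le_of_wellSpecified {b q j N r₀ : ℕ} {W E c0 c1 c2 c3 t l : ℝ}
    (hj : c.arm b q = j) (hN : c.len b j = N) (hi : P.iStar ≤ c.rep j) (hW : P.value ≤ W)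
    (hthr : 0 < c.thr j) (hE : 0 < E) (hc0 : 0 ≤ c0) (hc1 : 0 ≤ c1) (hc2 : 0 ≤ c2) (hc3 : 0 ≤ c3)
    (ht : 0 < t) (hl : 0 ≤ l)
    (hexc : ∀ r ≤ r₀, restartValue P L c.rule r (c.phaseStart (j + 1)) ≤ c1)
    (hcomp : ∀ r S, r + N = r₀ →
      restartValue P L c.rule r (b, q - 1, 0, 0, c.newBound N S W) ≤
        c0 + (if 2 * E < S - N * P.value then c2 else 0) +
          (if S - N * P.value < -c.conf * √N then c3 else 0))
    (m n r : ℕ) (S : ℝ) (s : ∀ i, (L i).State) (hm : 1 ≤ m) (hmn : n + m = N) (hr : r + n = r₀) :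
    blockValue P L c.rule r (s, (b, q, n, S, W)) ≤
      (1 + (c1 / c.thr j + c2 / (2 * E))) *
          regretToGo P (c.rep j) (L (c.rep j)) m (s (c.rep j)) + c0 +
        (c1 / c.thr j + c2 / (2 * E)) *
          (S - n * P.value + Real.exp (-t * (S - n * P.value) + t ^ 2 * m) / t) +
        c3 * Real.exp (-l * (S - n * P.value) + (l ^ 2 * m - l * (c.conf * √N))) := by
  -- The price per unit of excess loss in Markov's inequality: an alarm needs excess `thr j` and
  -- costs `c1`, a bad block needs excess `2 * E` and costs `c2`.
  set a := c1 / c.thr j + c2 / (2 * E) with ha_def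
  have ha1 : 0 ≤ c1 / c.thr j := by positivity
  have ha2 : 0 ≤ c2 / (2 * E) := by positivity
  have ha : 0 ≤ a := add_nonneg ha1 ha2
  induction m generalizing n r S s with
  | zero => omega
  | succ m ih =>
    rcases r with _ | r
    -- The horizon ends inside the block; every term of the potential is non-negative.
    · have h1 := regretToGo_nonneg P (c.rep j) (L (c.rep j)) hi (m + 1) (s (c.rep j))
      have h2 := add_exp_div_nonneg (x := S - n * P.value) (y := t ^ 2 * (m + 1 : ℕ)) ht
        (by positivity)
      have h3 : blockValue P L c.rule 0 (s, (b, q, n, S, W)) = 0 := rfl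
      rw [h3]
      positivity
    set x := S - n * P.value with hx
    have hxy : ∀ y, S + y - ((n + 1 : ℕ) : ℝ) * P.value = x + (y - P.value) := by
      intro y; rw [hx]; push_cast; ring
    set y1 := t ^ 2 * (m : ℝ) with hy1
    set y2 := l ^ 2 * (m : ℝ) - l * (c.conf * √N) with hy2
    set h : ℝ → ℝ := fun y => c0 + a * (x + (y - P.value) +
      Real.exp (-t * (x + (y - P.value)) + y1) / t) +
      c3 * Real.exp (-l * (x + (y - P.value)) + y2) with hh
    have hsel : c.rule.select (b, q, n, S, W) = c.rep j := by rw [← hj]; rfl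
    have hh' : h = fun y => (c0 + a * x) + a * (y - P.value) +
        (a * Real.exp (-t * x + y1) / t) * Real.exp (-t * (y - P.value)) +
        (c3 * Real.exp (-l * x + y2)) * Real.exp (-l * (y - P.value)) := by
      rw [hh]; funext y; rw [exp_add_mul, exp_add_mul]; ring
    have hu := integrable_sub_value_soloRound P (c.rep j) (L (c.rep j)) (s (c.rep j))
    have het := integrable_exp_soloRound P (c.rep j) (L (c.rep j)) (s (c.rep j)) (-t)
    have hel := integrable_exp_soloRound P (c.rep j) (L (c.rep j)) (s (c.rep j)) (-l)
    have hint : Integrable (fun z => h z.2)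
        (soloRound P (c.rep j) (L (c.rep j)) (s (c.rep j))) := by
      rw [hh']
      exact integrable_affine hu het hel _ _ _ _
    have hval : ∫ z, h z.2 ∂(soloRound P (c.rep j) (L (c.rep j)) (s (c.rep j))) ≤
        c0 + a * (x + roundRegret P (c.rep j) (L (c.rep j)) (s (c.rep j)) +
          Real.exp (-t * x + y1) * Real.exp (t ^ 2) / t) +
        c3 * (Real.exp (-l * x + y2) * Real.exp (l ^ 2)) := by
      have e1 := integral_exp_neg_soloRound_le P (c.rep j) (L (c.rep j)) hi (s (c.rep j)) ht.le
      have e2 := integral_exp_neg_soloRound_le P (c.rep j) (L (c.rep j)) hi (s (c.rep j)) hl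
      have e3 := integral_sub_value_soloRound P (c.rep j) (L (c.rep j)) (s (c.rep j))
      rw [hh', integral_affine hu het hel, e3]
      have k1 : 0 ≤ a * Real.exp (-t * x + y1) / t := by positivity
      have k2 : 0 ≤ c3 * Real.exp (-l * x + y2) := by positivity
      have := mul_le_mul_of_nonneg_left e1 k1
      have := mul_le_mul_of_nonneg_left e2 k2
      have e4 : a * (x + roundRegret P (c.rep j) (L (c.rep j)) (s (c.rep j)) +
          Real.exp (-t * x + y1) * Real.exp (t ^ 2) / t) = a * x +
          a * roundRegret P (c.rep j) (L (c.rep j)) (s (c.rep j)) +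
          a * Real.exp (-t * x + y1) / t * Real.exp (t ^ 2) := by ring
      linarith
    have key : blockValue P L c.rule (r + 1) (s, (b, q, n, S, W)) ≤
        roundRegret P (c.rep j) (L (c.rep j)) (s (c.rep j)) +
        (1 + a) * ∫ s', regretToGo P (c.rep j) (L (c.rep j)) m s'
          ∂(soloStep P (c.rep j) (L (c.rep j)) (s (c.rep j))) +
        ∫ z, h z.2 ∂(soloRound P (c.rep j) (L (c.rep j)) (s (c.rep j))) := by
      refine blockValue_succ_le P L c.rule r m s _ hsel
        (fun s' => mul_nonneg (by positivity) (regretToGo_nonneg P _ _ hi m s')) hint ?_ ?_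
      · intro y hy
        by_cases hex : ((b, q, n, S, W), y) ∈ c.exceeds
        · have hnext : c.rule.next ((b, q, n, S, W), y) = c.phaseStart (j + 1) := by
            change c.next _ = _
            rw [Config.next, if_pos hex, ← hj]
          have hlt : c.thr j < S + y - ((n + 1 : ℕ) : ℝ) * W := by rw [← hj]; exact hex
          have hn : (0 : ℝ) ≤ ((n + 1 : ℕ) : ℝ) := by positivity
          have hlt' : c.thr j ≤ x + (y - P.value) := by
            rw [← hxy]; nlinarith
          rw [hnext]
          have h1 := hexc r (by omega)
          -- As `W` is at least the optimal value, an alarm forces the true excess above `thr j`,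
          -- which pays for `c1`.
          have h2 : c1 ≤ a * (x + (y - P.value)) := by
            calc c1 = c1 / c.thr j * c.thr j := by field_simp
              _ ≤ a * (x + (y - P.value)) := by
                gcongr
                rw [ha_def]; linarith
          have h3 : 0 ≤ a * (Real.exp (-t * (x + (y - P.value)) + y1) / t) := by positivity
          have h4 : 0 ≤ c3 * Real.exp (-l * (x + (y - P.value)) + y2) := by positivity
          rw [hh]
          simp only
          linarith
        · have hco : ((b, q, n, S, W), y) ∈ c.completes := hy.resolve_left hex
          have hco' : n + 1 = N := by rw [← hN, ← hj]; exact hco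
          have hm0 : m = 0 := by omega
          have hnext : c.rule.next ((b, q, n, S, W), y) =
              (b, q - 1, 0, 0, c.newBound N (S + y) W) := by
            change c.next _ = _
            rw [Config.next, if_neg hex, if_pos hco, ← hN, ← hj]
          rw [hnext]
          refine (hcomp r (S + y) (by omega)).trans ?_
          rw [← hco', hxy, hco', hh]
          have hy10 : y1 = 0 := by rw [hy1, hm0]; simp
          have h1 : (if 2 * E < x + (y - P.value) then c2 else 0) ≤
              a * (x + (y - P.value) + Real.exp (-t * (x + (y - P.value)) + y1) / t) := by
            have hn0 := add_exp_div_nonneg (x := x + (y - P.value)) (y := y1) ht (by positivity)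
            split_ifs with hif
            · calc c2 = c2 / (2 * E) * (2 * E) := by field_simp
                _ ≤ a * (x + (y - P.value) + Real.exp (-t * (x + (y - P.value)) + y1) / t) := by
                  gcongr
                  · rw [ha_def]; linarith
                  · have : 0 ≤ Real.exp (-t * (x + (y - P.value)) + y1) / t := by positivity
                    linarith
            · positivity
          -- Chernoff's bound: at the end of the block the exponential is at least 1 when the losses
          -- are too small.
          have h2 : (if x + (y - P.value) < -c.conf * √N then c3 else 0) ≤
              c3 * Real.exp (-l * (x + (y - P.value)) + y2) := by
            split_ifs with hif
            · refine le_mul_of_one_le_right hc3 (Real.one_le_exp ?_)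
              rw [hy2, hm0]
              simp only [Nat.cast_zero, mul_zero, zero_sub]
              nlinarith
            · positivity
          linarith
      · intro y hy s'
        have hex : ((b, q, n, S, W), y) ∉ c.exceeds := fun h => hy (Or.inl h)
        have hco : ((b, q, n, S, W), y) ∉ c.completes := fun h => hy (Or.inr h)
        have hco' : n + 1 ≠ N := by rw [← hN, ← hj]; exact hco
        have hnext : c.rule.next ((b, q, n, S, W), y) = (b, q, n + 1, S + y, W) := by
          change c.next _ = _
          rw [Config.next, if_neg hex, if_neg hco]
        rw [hnext]
        have := ih (n + 1) r (S + y) s' (by omega) (by omega) (by omega)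
        rw [hxy] at this
        rw [hh]
        simp only
        linarith
    refine key.trans ?_
    have hρ : regretToGo P (c.rep j) (L (c.rep j)) (m + 1) (s (c.rep j)) =
        roundRegret P (c.rep j) (L (c.rep j)) (s (c.rep j)) +
          ∫ s', regretToGo P (c.rep j) (L (c.rep j)) m s'
            ∂(soloStep P (c.rep j) (L (c.rep j)) (s (c.rep j))) := rfl
    have e1 : Real.exp (-t * x + t ^ 2 * ((m + 1 : ℕ) : ℝ)) =
        Real.exp (-t * x + y1) * Real.exp (t ^ 2) := by
      rw [← Real.exp_add, hy1]; push_cast; ring_nf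
    have e2 : Real.exp (-l * x + (l ^ 2 * ((m + 1 : ℕ) : ℝ) - l * (c.conf * √N))) =
        Real.exp (-l * x + y2) * Real.exp (l ^ 2) := by
      rw [← Real.exp_add, hy2]; push_cast; ring_nf
    rw [hρ, e1, e2]
    linarith

/-- The regret from a state within a block of an arbitrary learner, if the bound `W` is accurate. -/
lemma blockValue_le_of_accurate {b q j N r₀ : ℕ} {W ε a e κ c0 : ℝ}
    (hj : c.arm b q = j) (hN : c.len b j = N) (hε : 0 ≤ ε) (hW : W ≤ P.value + ε)
    (ha : 0 ≤ a) (he : 0 ≤ e) (hκ : 0 < κ) (hc0 : 0 ≤ c0)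
    (hdrift : ∀ s, roundRegret P (c.rep j) (L (c.rep j)) s ≤
      a * (roundRegret P (c.rep j) (L (c.rep j)) s - ε) + e)
    (hexc : ∀ r ≤ r₀, restartValue P L c.rule r (c.phaseStart (j + 1)) ≤ c0)
    (hcomp : ∀ r S, r + N = r₀ →
      restartValue P L c.rule r (b, q - 1, 0, 0, c.newBound N S W) ≤ c0)
    (m n r : ℕ) (S : ℝ) (s : ∀ i, (L i).State) (hm : 1 ≤ m) (hmn : n + m = N) (hr : r + n = r₀)
    (hS : S - n * P.value - n * ε ≤ c.thr j) :
    blockValue P L c.rule r (s, (b, q, n, S, W)) ≤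
      a * (c.thr j - (S - n * P.value - n * ε)) + a * κ + a * (20 * m) / κ + m * e + c0 := by
  induction m generalizing n r S s with
  | zero => omega
  | succ m ih =>
    rcases r with _ | r
    · have h3 : blockValue P L c.rule 0 (s, (b, q, n, S, W)) = 0 := rfl
      rw [h3]
      have := mul_nonneg ha (sub_nonneg.2 hS)
      positivity
    set x := S - n * P.value - n * ε with hx
    have hxy : ∀ y, S + y - ((n + 1 : ℕ) : ℝ) * P.value - ((n + 1 : ℕ) : ℝ) * ε =
        x + (y - P.value) - ε := by
      intro y; rw [hx]; push_cast; ring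
    set C := a * (c.thr j - x + ε) + a * κ + a * (20 * m) / κ + m * e + c0 with hC
    set h : ℝ → ℝ := fun y => C - a * (y - P.value) + a / κ * (y - P.value) ^ 2 with hh
    have hsel : c.rule.select (b, q, n, S, W) = c.rep j := by rw [← hj]; rfl
    have hu := (integrable_sub_value_soloRound P (c.rep j) (L (c.rep j)) (s (c.rep j)))
    have hu2 := (integrable_sq_soloRound P (c.rep j) (L (c.rep j)) (s (c.rep j)))
    have hh' : h = fun y => C + (-a) * (y - P.value) + a / κ * (y - P.value) ^ 2 +
        0 * (y - P.value) := by
      rw [hh]; funext y; ring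
    have hint : Integrable (fun z => h z.2)
        (soloRound P (c.rep j) (L (c.rep j)) (s (c.rep j))) := by
      rw [hh']
      exact integrable_affine hu hu2 hu _ _ _ _
    have hval : ∫ z, h z.2 ∂(soloRound P (c.rep j) (L (c.rep j)) (s (c.rep j))) ≤
        C - a * roundRegret P (c.rep j) (L (c.rep j)) (s (c.rep j)) + a / κ * 20 := by
      have e2 := integral_sq_soloRound_le P (c.rep j) (L (c.rep j)) (s (c.rep j))
      have e3 := integral_sub_value_soloRound P (c.rep j) (L (c.rep j)) (s (c.rep j))
      rw [hh', integral_affine hu hu2 hu, e3]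
      have := mul_le_mul_of_nonneg_left e2 (show 0 ≤ a / κ by positivity)
      linarith
    -- The overshoot of the last round is at most `κ + (y - value) ^ 2 / κ`. The square is charged
    -- in every round because the stopping round is random, which gives the term `20 * m / κ`.
    have hend : ∀ y, c0 ≤ h y := by
      intro y
      have h1 : y - P.value ≤ κ + (y - P.value) ^ 2 / κ := by
        rcases le_total (y - P.value) κ with h | h
        · have : 0 ≤ (y - P.value) ^ 2 / κ := by positivity
          linarith
        · have : y - P.value ≤ (y - P.value) ^ 2 / κ := by
            rw [le_div_iff₀ hκ]; nlinarith
          linarith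
      have h2 := mul_le_mul_of_nonneg_left h1 ha
      have h3 := mul_nonneg ha (sub_nonneg.2 hS)
      have h4 : 0 ≤ a * ε := by positivity
      have h5 : 0 ≤ a * (20 * m) / κ := by positivity
      have h6 : 0 ≤ m * e := by positivity
      have h7 : a * (κ + (y - P.value) ^ 2 / κ) = a * κ + a / κ * (y - P.value) ^ 2 := by ring
      rw [hh, hC]
      simp only
      linarith
    -- Coefficient 0: nothing is known about the solo regret of this learner, and its regret is
    -- charged to the observed losses alone.
    have key : blockValue P L c.rule (r + 1) (s, (b, q, n, S, W)) ≤
        roundRegret P (c.rep j) (L (c.rep j)) (s (c.rep j)) +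
        0 * ∫ s', regretToGo P (c.rep j) (L (c.rep j)) m s'
          ∂(soloStep P (c.rep j) (L (c.rep j)) (s (c.rep j))) +
        ∫ z, h z.2 ∂(soloRound P (c.rep j) (L (c.rep j)) (s (c.rep j))) := by
      refine blockValue_succ_le P L c.rule r m s _ hsel (fun s' => by simp) hint ?_ ?_
      · intro y hy
        refine le_trans ?_ (hend y)
        by_cases hex : ((b, q, n, S, W), y) ∈ c.exceeds
        · have hnext : c.rule.next ((b, q, n, S, W), y) = c.phaseStart (j + 1) := by
            change c.next _ = _
            rw [Config.next, if_pos hex, ← hj]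
          rw [hnext]
          exact hexc r (by omega)
        · have hco : ((b, q, n, S, W), y) ∈ c.completes := hy.resolve_left hex
          have hco' : n + 1 = N := by rw [← hN, ← hj]; exact hco
          have hnext : c.rule.next ((b, q, n, S, W), y) =
              (b, q - 1, 0, 0, c.newBound N (S + y) W) := by
            change c.next _ = _
            rw [Config.next, if_neg hex, if_pos hco, ← hN, ← hj]
          rw [hnext]
          exact hcomp r (S + y) (by omega)
      · intro y hy s'
        have hex : ((b, q, n, S, W), y) ∉ c.exceeds := fun h => hy (Or.inl h)
        have hco : ((b, q, n, S, W), y) ∉ c.completes := fun h => hy (Or.inr h)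
        have hco' : n + 1 ≠ N := by rw [← hN, ← hj]; exact hco
        have hnext : c.rule.next ((b, q, n, S, W), y) = (b, q, n + 1, S + y, W) := by
          change c.next _ = _
          rw [Config.next, if_neg hex, if_neg hco]
        have hle : S + y - ((n + 1 : ℕ) : ℝ) * W ≤ c.thr j := by
          rw [← hj]; exact not_lt.1 hex
        have hn : (0 : ℝ) ≤ ((n + 1 : ℕ) : ℝ) := by positivity
        have hle' : S + y - ((n + 1 : ℕ) : ℝ) * P.value - ((n + 1 : ℕ) : ℝ) * ε ≤ c.thr j := by
          nlinarith
        rw [hnext]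
        have := ih (n + 1) r (S + y) s' (by omega) (by omega) (by omega) hle'
        rw [hxy] at this
        have h3 : 0 ≤ a / κ * (y - P.value) ^ 2 := by positivity
        rw [hh, hC]
        simp only
        linarith
    refine key.trans ?_
    -- The excess over `value + ε` grows on average by the round regret minus `ε`, so the fall of
    -- the potential pays for the regret up to `e`.
    have h1 := hdrift (s (c.rep j))
    have h2 : a * (20 * ((m + 1 : ℕ) : ℝ)) / κ = a * (20 * m) / κ + a / κ * 20 := by
      push_cast; ring
    rw [h2]
    push_cast
    rw [hC] at hval
    linarith

end Blocks

/-! ### The order of the arms and the accuracy of the bound. -/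

namespace Config

variable {K : ℕ} (c : Config K)

lemma le_arm (b q : ℕ) : b ≤ c.arm b q := Nat.le_add_right _ _

lemma arm_zero (b : ℕ) (hc : 0 < c.copies) : c.arm b 0 = b := by
  simp only [arm, zero_add, Nat.add_eq_left]
  exact Nat.div_eq_of_lt (by omega)

/-- The arm is `b` plus `q / copies` rounded up. Hence `copies * (k - 1) < q ≤ copies * k` are
exactly the blocks of arm `b + k`, and they are played with `q` decreasing. -/
lemma arm_le {b q k : ℕ} (hc : 0 < c.copies) (hq : q ≤ c.copies * k) : c.arm b q ≤ b + k := by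
  refine Nat.add_le_add_left (Nat.lt_succ_iff.1 ((Nat.div_lt_iff_lt_mul hc).2 ?_)) b
  rw [Nat.succ_mul, mul_comm k]
  omega

lemma lt_arm {b q k : ℕ} (hc : 0 < c.copies) (hq : c.copies * k < q) : b + k < c.arm b q := by
  refine Nat.add_lt_add_left (Nat.lt_of_succ_le ((Nat.le_div_iff_mul_le hc).2 ?_)) b
  rw [Nat.succ_mul, mul_comm k]
  omega

lemma newBound_le (N : ℕ) (S W : ℝ) : c.newBound N S W ≤ W := min_le_left _ _

lemma le_newBound {N : ℕ} {S W v : ℝ} (hN : 1 ≤ N) (hW : v ≤ W)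
    (hS : -c.conf * √N ≤ S - N * v) : v ≤ c.newBound N S W := by
  refine le_min hW ?_
  have hN' : (0 : ℝ) < N := by exact_mod_cast hN
  have h1 : c.conf / √N = c.conf * √N / N := by
    rw [div_eq_div_iff (by positivity) (by positivity), mul_assoc, Real.mul_self_sqrt hN'.le]
  rw [h1, ← add_div, le_div_iff₀ hN']
  linarith

lemma newBound_le_add {N : ℕ} {S W v x : ℝ} (hN : 1 ≤ N) (hS : S - N * v ≤ 2 * (x * √N)) :
    c.newBound N S W ≤ v + (2 * x + c.conf) / √N := by
  refine (min_le_right _ _).trans ?_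
  have hN' : (0 : ℝ) < N := by exact_mod_cast hN
  have h1 : 2 * x / √N = 2 * (x * √N) / N := by
    rw [div_eq_div_iff (by positivity) (by positivity)]
    have := Real.mul_self_sqrt hN'.le
    linear_combination (2 * x) * (-this)
  rw [add_div, h1, ← add_assoc]
  gcongr
  rw [div_le_iff₀ hN', add_mul, div_mul_cancel₀ _ hN'.ne']
  linarith

end Config

/-! ### Backward induction over blocks and phases. -/

section Phases

variable {X : Type u} {A : Type v} [MeasurableSpace X] [MeasurableSpace A] {K : ℕ} {d : Fin K → ℕ}
  (P : Problem X A d) (L : Fin K → BaseLearner.{u, v, w} X A) (c : Config K)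

/-- The relations between the parameters of the strategy which the analysis uses. The learners of
the arms `j ≥ k` are well-specified, and their regret over `t` rounds is of order `2 ^ j * √t`. -/
structure Calibrated (T k Q : ℕ) (C R l : ℝ) : Prop where
  one_le_T : 1 ≤ T
  one_le_C : 1 ≤ C
  one_le_R : 1 ≤ R
  l_nonneg : 0 ≤ l
  copies_pos : 0 < c.copies
  le_two_pow_copies : (T : ℝ) ≤ 2 ^ c.copies
  copies_mul_top_le : c.copies * c.top ≤ Q
  sqrt_le_two_pow : √T ≤ 2 ^ (c.top + 1)
  one_le_len : ∀ b j, j ≤ c.top → 1 ≤ c.len b j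
  len_le : ∀ b j, c.len b j ≤ T
  len_self : ∀ b ≤ c.top, c.len b b = T
  mul_sqrt_len_le : ∀ b j, j ≤ c.top → 2 ^ j * √(c.len b j) ≤ R * 2 ^ b * √T
  thr_eq : ∀ j, c.thr j = 2 ^ (j + 1) * (2 * (Q + 1) * (C * R)) * √T
  conf_nonneg : 0 ≤ c.conf
  tail_le : T * Real.exp (l ^ 2 - l * c.conf) ≤ 1
  wellSpecified : ∀ j, k ≤ j → P.iStar ≤ c.rep j
  soloRegret_le : ∀ j, k ≤ j → ∀ t ≤ T,
    soloRegret P (c.rep j) (L (c.rep j)) t + 3 * √t ≤ C * 2 ^ j * √t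

namespace Calibrated

variable {P L c} {T k Q : ℕ} {C R l : ℝ} (h : Calibrated P L c T k Q C R l)
include h

lemma one_le_sqrt : 1 ≤ √(T : ℝ) := by
  rw [Real.one_le_sqrt]
  exact_mod_cast h.one_le_T

lemma thr_pos (j : ℕ) : 0 < c.thr j := by
  have := h.one_le_sqrt
  have := h.one_le_C
  have := h.one_le_R
  rw [h.thr_eq]
  positivity

/-- A block of a well-specified learner, started anew. -/
lemma restartValue_block_le {b q j N r₀ : ℕ} {W c0 c1 c2 : ℝ}
    (hj : c.arm b q = j) (hN : c.len b j = N) (hk : k ≤ j) (htop : j ≤ c.top) (hW : P.value ≤ W)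
    (hc0 : 0 ≤ c0) (hc1 : 0 ≤ c1) (hc2 : 0 ≤ c2) (hr₀ : r₀ ≤ T)
    (hexc : ∀ r ≤ T, restartValue P L c.rule r (c.phaseStart (j + 1)) ≤ c1)
    (hcomp : ∀ r W', r + N = r₀ → P.value ≤ W' → W' ≤ W →
      restartValue P L c.rule r (b, q - 1, 0, 0, W') ≤
        c0 + (if P.value + (2 * (C * 2 ^ j) + c.conf) / √N < W' then c2 else 0)) :
    restartValue P L c.rule r₀ (b, q, 0, 0, W) ≤
      C * 2 ^ j * √N + c1 * (C * 2 ^ j * √N / c.thr j) + c0 + c2 / 2 + 1 := by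
  have hN1 : 1 ≤ N := hN ▸ h.one_le_len b j htop
  have hN' : (0 : ℝ) < N := by exact_mod_cast hN1
  have hsq : 0 < √(N : ℝ) := Real.sqrt_pos.2 hN'
  have hC := h.one_le_C
  have hi := h.wellSpecified j hk
  set E := C * 2 ^ j * √N with hE
  have hEpos : 0 < E := by positivity
  have hthr := h.thr_pos j
  have hl := h.l_nonneg
  -- With `t = 1 / √N` the exponential correction is `e * √N`, absorbed by the `3 * √t` in
  -- `soloRegret_le`. The cost `c3 = T` is the trivial bound when the confidence bound fails, and
  -- `tail_le` reduces its contribution to 1.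
  have hbound := blockValue_le_of_wellSpecified P L c (r₀ := r₀) (E := E) (c3 := T)
    (t := 1 / √N) (l := l / √N) hj hN hi hW hthr hEpos hc0 hc1 hc2 (by positivity)
    (by positivity) (by positivity) (fun r hr => hexc r (hr.trans hr₀)) ?_ N 0 r₀ 0
  · have e1 : (1 / √(N : ℝ)) ^ 2 * N = 1 := by
      rw [div_pow, Real.sq_sqrt hN'.le]; field_simp
    have e2 : (l / √(N : ℝ)) ^ 2 * N - l / √N * (c.conf * √N) = l ^ 2 - l * c.conf := by
      rw [div_pow, Real.sq_sqrt hN'.le]; field_simp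
    set a := c1 / c.thr j + c2 / (2 * E) with ha
    have ha0 : 0 ≤ a := by positivity
    have hint := ((integrable_of_abs_le (μ := (L (c.rep j)).init)
      (measurable_regretToGo P (c.rep j) (L (c.rep j)) N)
      (abs_regretToGo_le P (c.rep j) (L (c.rep j)) N)).const_mul (1 + a))
    have hle := restartValue_le_integral P L c.rule r₀ (b, q, 0, 0, W) (c.rep j)
      (hint.add (integrable_const (c0 + a * (Real.exp 1 * √N) + 1))) fun s => ?_
    · refine hle.trans ?_
      have hs : ∫ s, ((1 + a) * regretToGo P (c.rep j) (L (c.rep j)) N s +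
          (c0 + a * (Real.exp 1 * √N) + 1)) ∂(L (c.rep j)).init =
          (1 + a) * soloRegret P (c.rep j) (L (c.rep j)) N +
          (c0 + a * (Real.exp 1 * √N) + 1) := by
        rw [integral_add hint (integrable_const _), integral_const_mul, ← soloRegret_eq]
        simp
      refine hs.le.trans ?_
      have hsolo := h.soloRegret_le j hk N (hN ▸ h.len_le b j)
      have hexp : Real.exp 1 * √N ≤ 3 * √N :=
        mul_le_mul_of_nonneg_right (Real.exp_one_lt_d9.le.trans (by norm_num)) hsq.le
      have haE : a * E = c1 * (E / c.thr j) + c2 / 2 := by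
        rw [ha]; field_simp
      have h1 : a * (soloRegret P (c.rep j) (L (c.rep j)) N + Real.exp 1 * √N) ≤ a * E :=
        mul_le_mul_of_nonneg_left (by linarith) ha0
      linarith
    · refine (hbound s hN1 (by omega) (by omega)).trans ?_
      simp only [Nat.cast_zero, zero_mul, sub_self, mul_zero, zero_add]
      rw [e1, e2]
      have e3 : Real.exp 1 / (1 / √(N : ℝ)) = Real.exp 1 * √N := by field_simp
      rw [e3]
      have := h.tail_le
      simp only [Pi.add_apply]
      linarith
  · intro r S hr
    split_ifs with h1 h2 h2
    · exact (restartValue_le P L c.rule r _).trans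
        (by have : (r : ℝ) ≤ T := by exact_mod_cast (by omega)
            linarith)
    · rw [add_zero]
      refine (hcomp r _ hr (c.le_newBound hN1 hW (not_lt.1 h2)) (c.newBound_le _ _ _)).trans ?_
      split_ifs <;> linarith
    · exact (restartValue_le P L c.rule r _).trans
        (by have : (r : ℝ) ≤ T := by exact_mod_cast (by omega)
            linarith)
    · refine (hcomp r _ hr (c.le_newBound hN1 hW (not_lt.1 h2)) (c.newBound_le _ _ _)).trans ?_
      rw [if_neg]
      · linarith
      · exact not_lt.2 (c.newBound_le_add hN1 (not_lt.1 h1))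

/-- A block of an arbitrary learner, started anew with an accurate bound. -/
lemma restartValue_block_le_of_accurate {b q j r₀ : ℕ} {W ε a e c0 : ℝ}
    (hj : c.arm b q = j) (htop : j ≤ c.top) (hε : 0 ≤ ε) (hW : W ≤ P.value + ε)
    (ha : 0 ≤ a) (he : 0 ≤ e) (hc0 : 0 ≤ c0) (hr₀ : r₀ ≤ T)
    (hdrift : ∀ s, roundRegret P (c.rep j) (L (c.rep j)) s ≤
      a * (roundRegret P (c.rep j) (L (c.rep j)) s - ε) + e)
    (hexc : ∀ r ≤ T, restartValue P L c.rule r (c.phaseStart (j + 1)) ≤ c0)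
    (hcomp : ∀ r W', r + c.len b j = r₀ → W' ≤ P.value + ε →
      restartValue P L c.rule r (b, q - 1, 0, 0, W') ≤ c0) :
    restartValue P L c.rule r₀ (b, q, 0, 0, W) ≤
      a * c.thr j + 21 * a * √T + c.len b j * e + c0 := by
  have hN1 : 1 ≤ c.len b j := h.one_le_len b j htop
  have hT : (0 : ℝ) < T := by exact_mod_cast h.one_le_T
  have hsq : 0 < √(T : ℝ) := Real.sqrt_pos.2 hT
  -- For `κ = √T` the overshoot costs at most `a * √T + 20 * a * √T`, since the length is at most
  -- `T`.
  have hbound := fun s => blockValue_le_of_accurate P L c (r₀ := r₀) (κ := √T) hj rfl hε hW ha he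
    hsq hc0 hdrift (fun r hr => hexc r (hr.trans hr₀))
    (fun r S hr => hcomp r _ hr ((c.newBound_le _ _ _).trans hW)) (c.len b j) 0 r₀ 0 s hN1
    (by omega) (by omega) (by simpa using (h.thr_pos j).le)
  have hle := restartValue_le_integral P L c.rule r₀ (b, q, 0, 0, W) (c.rep j)
    (integrable_const _) hbound
  refine hle.trans ?_
  simp only [integral_const, probReal_univ, one_smul, Nat.cast_zero, zero_mul, sub_zero]
  have h1 : a * (20 * (c.len b j : ℝ)) / √T ≤ 20 * a * √T := by
    have h2 : (c.len b j : ℝ) ≤ √T * √T := by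
      rw [Real.mul_self_sqrt hT.le]; exact_mod_cast h.len_le b j
    rw [div_le_iff₀ hsq]
    nlinarith
  linarith

/-- A block of a well-specified learner, for the bound of the false alarms in later phases. -/
lemma restartValue_block_le' {b q j r₀ : ℕ} {W c0 c2 : ℝ}
    (hj : c.arm b q = j) (hk : k ≤ j) (htop : j ≤ c.top) (hW : P.value ≤ W)
    (hc0 : 0 ≤ c0) (hc2 : 0 ≤ c2) (hr₀ : r₀ ≤ T)
    (hexc : ∀ r ≤ T, restartValue P L c.rule r (c.phaseStart (j + 1)) ≤
      2 * (Q + 1) * (C * R + 1) * 2 ^ (j + 1) * √T)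
    (hcomp : ∀ r W', r + c.len b j = r₀ → P.value ≤ W' → W' ≤ W →
      restartValue P L c.rule r (b, q - 1, 0, 0, W') ≤
        c0 + (if P.value + (2 * (C * 2 ^ j) + c.conf) / √(c.len b j) < W' then c2 else 0)) :
    restartValue P L c.rule r₀ (b, q, 0, 0, W) ≤
      2 * (C * R + 1) * 2 ^ b * √T + c0 + c2 / 2 := by
  have hC := h.one_le_C
  have hR := h.one_le_R
  have hsT := h.one_le_sqrt
  have h1 := h.restartValue_block_le hj rfl hk htop hW hc0 (by positivity) hc2 hr₀ hexc hcomp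
  refine h1.trans ?_
  have hE : C * 2 ^ j * √(c.len b j) ≤ C * R * 2 ^ b * √T := by
    have := mul_le_mul_of_nonneg_left (h.mul_sqrt_len_le b j htop) (zero_le_one.trans hC)
    linarith
  -- The form of `thr` is made for this cancellation: the factors `2 ^ (j + 1)` and `Q + 1` in the
  -- cost of phase `j + 1` disappear against the probability of the alarm.
  have hfalse : 2 * (Q + 1) * (C * R + 1) * 2 ^ (j + 1) * √T *
      (C * 2 ^ j * √(c.len b j) / c.thr j) ≤ (C * R + 1) * 2 ^ b * √T := by
    rw [h.thr_eq, ← mul_div_assoc, div_le_iff₀ (by positivity)]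
    have := mul_le_mul_of_nonneg_left hE
      (show 0 ≤ 2 * ((Q : ℝ) + 1) * (C * R + 1) * 2 ^ (j + 1) * √T by positivity)
    linarith
  have h2b : (1 : ℝ) ≤ 2 ^ b * √T := by
    have : (1 : ℝ) ≤ 2 ^ b := one_le_pow₀ (by norm_num)
    nlinarith
  linarith

/-- The regret from a phase on whose arm is well-specified. -/
lemma restartValue_phaseStart_le_of_le (b : ℕ) (hb : k ≤ b) (r : ℕ) (hr : r ≤ T) :
    restartValue P L c.rule r (c.phaseStart b) ≤
      2 * (Q + 1) * (C * R + 1) * 2 ^ b * √T := by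
  have hC := h.one_le_C
  have hR := h.one_le_R
  have hsT := h.one_le_sqrt
  have hV1 := P.value_le_one
  have hc := h.copies_pos
  induction hn : c.top + 1 - b using Nat.strong_induction_on generalizing b r with
  | _ n ih =>
  rcases Nat.lt_or_ge c.top b with htop | htop
  -- Beyond `top` the claim is weaker than the trivial bound by the number of rounds.
  · have h1 : (T : ℝ) ≤ 2 ^ b * √T := by
      calc (T : ℝ) = √T * √T := (Real.mul_self_sqrt (by positivity)).symm
        _ ≤ 2 ^ (c.top + 1) * √T := by gcongr; exact h.sqrt_le_two_pow
        _ ≤ 2 ^ b * √T := by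
          gcongr
          · norm_num
          · exact htop
    have h2 : (1 : ℝ) ≤ 2 * (Q + 1) * (C * R + 1) := by
      have : 1 ≤ 2 * ((Q : ℝ) + 1) := by
        have : (0 : ℝ) ≤ Q := by positivity
        linarith
      have : 1 ≤ C * R + 1 := by
        have : 0 ≤ C * R := by positivity
        linarith
      nlinarith
    have h3 : (r : ℝ) ≤ T := by exact_mod_cast hr
    have h4 := mul_le_mul_of_nonneg_right h2 (show 0 ≤ 2 ^ b * √(T : ℝ) by positivity)
    linarith [restartValue_le P L c.rule r (c.phaseStart b)]
  · have hexc : ∀ j, b ≤ j → ∀ r ≤ T, restartValue P L c.rule r (c.phaseStart (j + 1)) ≤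
        2 * (Q + 1) * (C * R + 1) * 2 ^ (j + 1) * √T := fun j hj r hr =>
      ih (c.top + 1 - (j + 1)) (by omega) (j + 1) (by omega) r hr rfl
    have key : ∀ q, q ≤ c.copies * (c.top - b) → ∀ r ≤ T, ∀ W, P.value ≤ W →
        restartValue P L c.rule r (b, q, 0, 0, W) ≤
          (q + 1) * (2 * (C * R + 1) * 2 ^ b * √T) := by
      intro q
      induction q with
      | zero =>
        intro _ r hr W hW
        have harm := c.arm_zero b hc
        have := h.restartValue_block_le' (c0 := 0) (c2 := 0) harm hb htop hW le_rfl le_rfl hr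
          (hexc b le_rfl) fun r' W' hr' _ _ => by
            -- The block of arm `b` has length `T`, so no rounds remain once it is complete.
            rw [h.len_self b htop] at hr'
            have : r' = 0 := by omega
            rw [this, restartValue_zero]
            simp
        simpa using this
      | succ q ihq =>
        intro hq r hr W hW
        have harm : c.arm b (q + 1) ≤ c.top := by
          have := c.arm_le (b := b) hc hq
          omega
        have := h.restartValue_block_le' (c0 := (q + 1) * (2 * (C * R + 1) * 2 ^ b * √T))
          (c2 := 0) rfl (hb.trans (c.le_arm b (q + 1))) harm hW (by positivity) le_rfl hr
          (hexc _ (c.le_arm b (q + 1))) fun r' W' hr' hW' _ => by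
            simpa using ihq (by omega) r' (by omega) W' hW'
        push_cast
        linarith
    refine (key _ le_rfl r hr 1 hV1).trans ?_
    have hQ : ((c.copies * (c.top - b) : ℕ) : ℝ) ≤ Q := by
      exact_mod_cast (Nat.mul_le_mul_left _ (Nat.sub_le _ _)).trans h.copies_mul_top_le
    have := mul_le_mul_of_nonneg_right hQ
      (show 0 ≤ 2 * (C * R + 1) * 2 ^ b * √(T : ℝ) by positivity)
    linarith

/-- The regret from a phase on whose arm is misspecified, in terms of a bound `M` of the regret in
the blocks of misspecified learners. -/
lemma restartValue_phaseStart_le_of_lt {b : ℕ} (hb : b < k) (hk : k ≤ c.top) {M F : ℝ} (hM : 0 ≤ M)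
    (hF : 0 ≤ F)
    (hmis : ∀ j, b ≤ j → j < k → ∃ a e, 0 ≤ a ∧ 0 ≤ e ∧
      (∀ s, roundRegret P (c.rep j) (L (c.rep j)) s ≤
        a * (roundRegret P (c.rep j) (L (c.rep j)) s -
          (2 * (C * 2 ^ k) + c.conf) / √(c.len b k)) + e) ∧
      a * c.thr j + 21 * a * √T + c.len b j * e ≤ M)
    (hnext : ∀ j, b ≤ j → j < k → ∀ r ≤ T,
      restartValue P L c.rule r (c.phaseStart (j + 1)) ≤ F)
    (r : ℕ) (hr : r ≤ T) :
    restartValue P L c.rule r (c.phaseStart b) ≤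
      2 * (Q + 1) * (C * R + 1) * 2 ^ b * √T + (Q + 1) * M + F + 1 := by
  have hC := h.one_le_C
  have hR := h.one_le_R
  have hsT := h.one_le_sqrt
  have hV1 := P.value_le_one
  have hc := h.copies_pos
  have hconf := h.conf_nonneg
  set ε := (2 * (C * 2 ^ k) + c.conf) / √(c.len b k) with hε_def
  have hε : 0 ≤ ε := by positivity
  set B := 2 * (C * R + 1) * 2 ^ b * √(T : ℝ) with hB_def
  have hB : 0 ≤ B := by positivity
  have hexc : ∀ j, k ≤ j → ∀ r ≤ T, restartValue P L c.rule r (c.phaseStart (j + 1)) ≤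
      2 * (Q + 1) * (C * R + 1) * 2 ^ (j + 1) * √T := fun j hj r hr =>
    h.restartValue_phaseStart_le_of_le (j + 1) (by omega) r hr
  have hQ : ∀ n ≤ c.top, ((c.copies * n : ℕ) : ℝ) ≤ Q := fun n hn => by
    exact_mod_cast (Nat.mul_le_mul_left _ hn).trans h.copies_mul_top_le
  -- After arm `k` only the upper bound on `W` is kept. Misspecified losses may push `W` below the
  -- optimal value; an alarm here is harmless because it leads to a phase at most `k`, whose cost
  -- `F` is charged in full.
  have mis : ∀ q, q ≤ c.copies * (k - b - 1) → ∀ r ≤ T, ∀ W, W ≤ P.value + ε →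
      restartValue P L c.rule r (b, q, 0, 0, W) ≤ (q + 1) * M + F := by
    intro q
    induction q with
    | zero =>
      intro _ r hr W hW
      have harm := c.arm_zero b hc
      obtain ⟨a, e, ha, he, hdrift, hle⟩ := hmis b le_rfl hb
      have := h.restartValue_block_le_of_accurate harm (by omega) hε hW ha he hF hr hdrift
        (hnext b le_rfl hb) fun r' W' hr' _ => by
          rw [h.len_self b (by omega)] at hr'
          have : r' = 0 := by omega
          rw [this, restartValue_zero]
          exact hF
      push_cast
      linarith
    | succ q ihq =>
      intro hq r hr W hW
      have harm := c.arm_le (b := b) hc hq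
      have harm' := c.le_arm b (q + 1)
      obtain ⟨a, e, ha, he, hdrift, hle⟩ := hmis (c.arm b (q + 1)) harm' (by omega)
      have := h.restartValue_block_le_of_accurate (c0 := (q + 1) * M + F) rfl (by omega) hε hW ha
        he (by positivity) hr hdrift
        (fun r hr => (hnext (c.arm b (q + 1)) harm' (by omega) r hr).trans (by
          have : 0 ≤ ((q : ℝ) + 1) * M := by positivity
          linarith)) fun r' W' hr' hW' => ihq (by omega) r' (by omega) W' hW'
      push_cast
      linarith
  set Y := (Q + 1) * M + F with hY_def
  have hY : 0 ≤ Y := by positivity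
  -- While `W` is inaccurate the trivial cost `T` is carried along; every further block of arm `k`
  -- halves it through the term `c2 / 2`.
  have best : ∀ m, m ≤ c.copies → ∀ r ≤ T, ∀ W, P.value ≤ W →
      restartValue P L c.rule r (b, c.copies * (k - b - 1) + m, 0, 0, W) ≤
        m * B + Y + (if P.value + ε < W then (T : ℝ) / 2 ^ m else 0) := by
    intro m
    induction m with
    | zero =>
      intro _ r hr W hW
      split_ifs with hif
      · have h1 := restartValue_le P L c.rule r (b, c.copies * (k - b - 1) + 0, 0, 0, W)
        have h2 : (r : ℝ) ≤ T := by exact_mod_cast hr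
        simp only [pow_zero, div_one, Nat.cast_zero, zero_mul]
        linarith
      · have h1 := mis _ le_rfl r hr W (not_lt.1 hif)
        have h2 := mul_le_mul_of_nonneg_right (hQ (k - b - 1) (by omega)) hM
        simp only [add_zero, Nat.cast_zero, zero_mul]
        rw [hY_def]
        linarith
    | succ m ihm =>
      intro hm r hr W hW
      have harm : c.arm b (c.copies * (k - b - 1) + (m + 1)) = k := by
        have h1 := c.lt_arm (b := b) (q := c.copies * (k - b - 1) + (m + 1)) (k := k - b - 1) hc
          (by omega)
        have h2 := c.arm_le (b := b) (q := c.copies * (k - b - 1) + (m + 1)) (k := k - b - 1 + 1) hc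
          (by rw [Nat.mul_succ]; omega)
        omega
      have := h.restartValue_block_le' (c0 := m * B + Y)
        (c2 := if P.value + ε < W then (T : ℝ) / 2 ^ m else 0) harm le_rfl hk hW (by positivity)
        (by split_ifs <;> positivity) hr (hexc k le_rfl) fun r' W' hr' hW' hWW => by
          refine (ihm (by omega) r' (by omega) W' hW').trans (le_of_eq ?_)
          congr 1
          -- The bound never increases within a phase, so accuracy, once reached, is kept.
          by_cases h1 : P.value + ε < W'
          · rw [if_pos h1, if_pos (h1.trans_le hWW), if_pos h1]
          · rw [if_neg h1, if_neg h1]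
      refine this.trans (le_of_eq ?_)
      split_ifs
      · push_cast; rw [pow_succ]; field_simp; ring
      · push_cast; ring
  -- Arms above `k` need no accurate `W`; each of their blocks costs at most `B`, false alarms
  -- included.
  have explore : ∀ m, c.copies * (k - b) + m ≤ c.copies * (c.top - b) → ∀ r ≤ T, ∀ W,
      P.value ≤ W → restartValue P L c.rule r (b, c.copies * (k - b) + m, 0, 0, W) ≤
        (c.copies + m) * B + Y + 1 := by
    intro m
    induction m with
    | zero =>
      intro _ r hr W hW
      have h1 := best c.copies le_rfl r hr W hW
      have h2 : c.copies * (k - b - 1) + c.copies = c.copies * (k - b) + 0 := by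
        rw [← Nat.mul_succ, add_zero]; congr 1; omega
      rw [h2] at h1
      refine h1.trans ?_
      have h3 : (T : ℝ) / 2 ^ c.copies ≤ 1 := by
        rw [div_le_one (by positivity)]; exact h.le_two_pow_copies
      simp only [Nat.cast_zero, add_zero]
      split_ifs <;> linarith
    | succ m ihm =>
      intro hm r hr W hW
      have harm := c.lt_arm (b := b) (q := c.copies * (k - b) + (m + 1)) (k := k - b) hc (by omega)
      have harm' := c.arm_le (b := b) hc hm
      have := h.restartValue_block_le' (c0 := (c.copies + m) * B + Y + 1) (c2 := 0)
        (b := b) (q := c.copies * (k - b) + (m + 1)) rfl (by omega) (by omega) hW (by positivity)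
        le_rfl hr (hexc _ (by omega)) fun r' W' hr' hW' _ => by
          simpa using ihm (by omega) r' (by omega) W' hW'
      push_cast
      linarith
  have hsplit : c.copies * (c.top - b) = c.copies * (k - b) + c.copies * (c.top - k) := by
    rw [← Nat.mul_add]; congr 1; omega
  have hfin := explore (c.copies * (c.top - k)) hsplit.ge r hr 1 hV1
  rw [← hsplit] at hfin
  refine hfin.trans ?_
  have h1 : ((c.copies : ℝ) + (c.copies * (c.top - k) : ℕ)) ≤ Q := by
    have h2 : c.copies + c.copies * (c.top - k) ≤ c.copies * c.top := by
      rw [add_comm, ← Nat.mul_succ]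
      exact Nat.mul_le_mul_left _ (by omega)
    exact_mod_cast h2.trans h.copies_mul_top_le
  have h2 := mul_le_mul_of_nonneg_right h1 hB
  rw [hY_def, hB_def] at *
  linarith

/-- The regret of the strategy, in terms of a bound `M` of the regret in the blocks of misspecified
learners. -/
lemma restartValue_phaseStart_le (hk : k ≤ c.top) {M : ℝ} (hM : 0 ≤ M) {b₀ : ℕ}
    (hmis : ∀ b j, b₀ ≤ b → b ≤ j → j < k → ∃ a e, 0 ≤ a ∧ 0 ≤ e ∧
      (∀ s, roundRegret P (c.rep j) (L (c.rep j)) s ≤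
        a * (roundRegret P (c.rep j) (L (c.rep j)) s -
          (2 * (C * 2 ^ k) + c.conf) / √(c.len b k)) + e) ∧
      a * c.thr j + 21 * a * √T + c.len b j * e ≤ M)
    (b : ℕ) (hb₀ : b₀ ≤ b) (hb : b ≤ k) (r : ℕ) (hr : r ≤ T) :
    restartValue P L c.rule r (c.phaseStart b) ≤
      (k - b : ℕ) * (2 * (Q + 1) * (C * R + 1) * 2 ^ k * √T + (Q + 1) * M + 1) +
        2 * (Q + 1) * (C * R + 1) * 2 ^ k * √T := by
  have hC := h.one_le_C
  have hR := h.one_le_R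
  have hsT := h.one_le_sqrt
  induction hn : k - b using Nat.strong_induction_on generalizing b r with
  | _ n ih =>
  rcases hb.eq_or_lt with rfl | hlt
  · have h0 : n = 0 := by omega
    rw [h0]
    simpa using h.restartValue_phaseStart_le_of_le b le_rfl r hr
  · set G := 2 * (Q + 1) * (C * R + 1) * 2 ^ k * √(T : ℝ) with hG
    have hG0 : 0 ≤ G := by positivity
    have hH : 0 ≤ G + (Q + 1) * M + 1 := by positivity
    have h1 := h.restartValue_phaseStart_le_of_lt hlt hk hM
      -- An alarm of a misspecified arm moves to a strictly later phase, so at most `n - 1` phases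
      -- below `k` remain after this one.
      (F := (n - 1 : ℕ) * (G + (Q + 1) * M + 1) + G) (by positivity)
      (fun j h1 h2 => hmis b j hb₀ h1 h2) (fun j h1 h2 r hr => by
        refine (ih (k - (j + 1)) (by omega) (j + 1) (by omega) (by omega) r hr rfl).trans ?_
        have h3 : ((k - (j + 1) : ℕ) : ℝ) ≤ (n - 1 : ℕ) := by
          exact_mod_cast (by omega : k - (j + 1) ≤ n - 1)
        linarith [mul_le_mul_of_nonneg_right h3 hH]) r hr
    refine h1.trans ?_
    have h2 : 2 * (Q + 1) * (C * R + 1) * 2 ^ b * √(T : ℝ) ≤ G := by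
      rw [hG]
      gcongr
      norm_num
    have h3 : (n : ℝ) = (n - 1 : ℕ) + 1 := by
      rw [Nat.cast_sub (by omega)]; simp
    rw [h3]
    linarith

end Calibrated

end Phases

/-! ### The parameters of the strategy -/

/-- The order of the regret of the base learners, up to a dyadic factor. -/
def regretFactor (C : ℝ) (p T : ℕ) : ℝ := 2 * C * (1 + Real.log T) ^ p + 3

/-- The relative accuracy of the bounds of the optimal value. -/
def accuracyFactor (C : ℝ) (p T : ℕ) : ℝ := 2 * regretFactor C p T + (1 + Real.log T + 1)

/-- The exponent of the exploration factor. -/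
def explorationExponent (C : ℝ) (p T : ℕ) : ℕ := Nat.clog 2 ⌈4 * accuracyFactor C p T⌉₊

/-- The number of exploration blocks. -/
def blockCount (T : ℕ) : ℕ := (Nat.log 2 T + 1) * Nat.log 4 T

/-- The base learner with the largest index among those of order less than `2 ^ (j + 1)`. -/
def armLearner (α : ℝ) {K : ℕ} (hK : 0 < K) (d : Fin K → ℕ) (j : ℕ) : Fin K :=
  if h : (Finset.univ.filter fun i => (d i : ℝ) ^ α < 2 ^ (j + 1)).Nonempty then
    (Finset.univ.filter fun i => (d i : ℝ) ^ α < 2 ^ (j + 1)).max' h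
  else ⟨0, hK⟩

/-- The smallest arm that is represented by a base learner. -/
def firstArm (α : ℝ) {K : ℕ} (d : Fin K → ℕ) : ℕ :=
  sInf {b | ∃ i, (d i : ℝ) ^ α < 2 ^ (b + 1)}

/-- The parameters of the strategy. -/
def config (α C : ℝ) (p T : ℕ) {K : ℕ} (hK : 0 < K) (d : Fin K → ℕ) : Config K where
  copies := Nat.log 2 T + 1
  top := Nat.log 4 T
  -- The factor `4 ^ b / 4 ^ j` makes the regret in a block of arm `j` scale like `2 ^ b * √T`. The
  -- extra `4 ^ explorationExponent` lengthens exploration by a polylogarithmic factor, to make `W`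
  -- accurate enough to exploit the gap.
  len b j := min T (T * 4 ^ (b + explorationExponent C p T) / 4 ^ j)
  thr j := 2 ^ (j + 1) * (2 * ((blockCount T : ℝ) + 1) *
    (regretFactor C p T * 2 ^ explorationExponent C p T)) * √T
  conf := 1 + Real.log T + 1
  rep := armLearner α hK d
  first := firstArm α d

/-! ### Dyadic grouping of the base learners. -/

section Arms

variable {α : ℝ} {K : ℕ} (hK : 0 < K) (d : Fin K → ℕ)

lemma exists_lt_two_pow_succ (x : ℝ) : ∃ b : ℕ, x < 2 ^ (b + 1) := by
  obtain ⟨n, hn⟩ := pow_unbounded_of_one_lt x (one_lt_two)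
  exact ⟨n, hn.trans_le (pow_le_pow_right₀ one_le_two (Nat.le_succ n))⟩

lemma armLearner_lt {j : ℕ} {i : Fin K} (hi : (d i : ℝ) ^ α < 2 ^ (j + 1)) :
    (d (armLearner α hK d j) : ℝ) ^ α < 2 ^ (j + 1) := by
  have h : (Finset.univ.filter fun i => (d i : ℝ) ^ α < 2 ^ (j + 1)).Nonempty := ⟨i, by simpa⟩
  rw [armLearner, dif_pos h]
  have := Finset.max'_mem _ h
  simpa using this

/-- The reason for taking the largest index: an arm whose range contains `iStar` has a
well-specified representative even if misspecified learners share its scale. -/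
lemma le_armLearner {j : ℕ} {i : Fin K} (hi : (d i : ℝ) ^ α < 2 ^ (j + 1)) :
    i ≤ armLearner α hK d j := by
  have h : (Finset.univ.filter fun i => (d i : ℝ) ^ α < 2 ^ (j + 1)).Nonempty := ⟨i, by simpa⟩
  rw [armLearner, dif_pos h]
  exact Finset.le_max' _ _ (by simpa)

/-- Below `firstArm` the representative is the default index 0, without a bound on its dimension;
hence the strategy starts at phase `firstArm`. -/
lemma armLearner_lt_of_firstArm_le {j : ℕ} (hj : firstArm α d ≤ j) :
    (d (armLearner α hK d j) : ℝ) ^ α < 2 ^ (j + 1) := by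
  have hne : {b | ∃ i, (d i : ℝ) ^ α < 2 ^ (b + 1)}.Nonempty := by
    obtain ⟨b, hb⟩ := exists_lt_two_pow_succ ((d ⟨0, hK⟩ : ℝ) ^ α)
    exact ⟨b, ⟨0, hK⟩, hb⟩
  obtain ⟨i, hi⟩ := Nat.sInf_mem hne
  exact armLearner_lt hK d (hi.trans_le (pow_le_pow_right₀ one_le_two (Nat.succ_le_succ hj)))

end Arms

/-! ### Bounds of the logarithmic factors. -/

section Constants

variable {C : ℝ} {p T : ℕ}

lemma one_le_one_add_log (hT : 1 ≤ T) : 1 ≤ 1 + Real.log T := by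
  have := Real.log_nonneg (by exact_mod_cast hT : (1 : ℝ) ≤ T)
  linarith

lemma three_le_regretFactor (hC : 0 < C) (hT : 1 ≤ T) : 3 ≤ regretFactor C p T := by
  have := one_le_one_add_log hT
  have : 0 ≤ 2 * C * (1 + Real.log T) ^ p := by positivity
  unfold regretFactor
  linarith

lemma regretFactor_le_accuracyFactor (hC : 0 < C) (hT : 1 ≤ T) :
    regretFactor C p T ≤ accuracyFactor C p T := by
  have h1 := three_le_regretFactor (p := p) hC hT
  have h2 := one_le_one_add_log hT
  unfold accuracyFactor
  linarith

lemma four_mul_accuracyFactor_le :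
    4 * accuracyFactor C p T ≤ 2 ^ explorationExponent C p T := by
  refine (Nat.le_ceil _).trans ?_
  exact_mod_cast Nat.le_pow_clog one_lt_two _

/-- Rounding up to a power of two at most doubles `⌈4 * A⌉ ≤ 4 * A + 1`, and `8 * A + 2 ≤ 10 * A`.
-/
lemma two_pow_explorationExponent_le (hC : 0 < C) (hT : 1 ≤ T) :
    (2 : ℝ) ^ explorationExponent C p T ≤ 10 * accuracyFactor C p T := by
  have h1 := (three_le_regretFactor (p := p) hC hT).trans
    (regretFactor_le_accuracyFactor (p := p) hC hT)
  set n := ⌈4 * accuracyFactor C p T⌉₊ with hn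
  have h2 : (n : ℝ) < 4 * accuracyFactor C p T + 1 := Nat.ceil_lt_add_one (by linarith)
  have h3 : 1 < n := by
    have : (1 : ℝ) < n := lt_of_lt_of_le (by linarith) (Nat.le_ceil (4 * accuracyFactor C p T))
    exact_mod_cast this
  have h4 := Nat.pow_pred_clog_lt_self one_lt_two h3
  have h5 : 0 < Nat.clog 2 n := Nat.clog_pos one_lt_two h3
  have h6 : 2 ^ Nat.clog 2 n < 2 * n := by
    calc 2 ^ Nat.clog 2 n = 2 * 2 ^ (Nat.clog 2 n).pred := by
          rw [← pow_succ']; congr 1; exact (Nat.succ_pred_eq_of_pos h5).symm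
      _ < 2 * n := by omega
  have h7 : (2 : ℝ) ^ Nat.clog 2 n < 2 * n := by exact_mod_cast h6
  unfold explorationExponent
  rw [← hn]
  linarith

lemma log_le_of_pow_le {b n : ℕ} (hT : 1 ≤ T) (hn : n = Nat.log b T) :
    (n : ℝ) * Real.log b ≤ Real.log T := by
  rw [← Real.log_pow]
  rcases Nat.eq_zero_or_pos b with rfl | hb
  · simp [hn, Real.log_nonneg (by exact_mod_cast hT : (1 : ℝ) ≤ T)]
  · refine Real.log_le_log (by positivity) ?_
    exact_mod_cast hn ▸ Nat.pow_log_le_self b (by omega)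

lemma blockCount_add_one_le (hT : 1 ≤ T) :
    (blockCount T : ℝ) + 1 ≤ 2 * (1 + Real.log T) ^ 2 := by
  have hl := Real.log_nonneg (by exact_mod_cast hT : (1 : ℝ) ≤ T)
  have h2 := log_le_of_pow_le (b := 2) hT rfl
  have h4 := log_le_of_pow_le (b := 4) hT rfl
  have hlog2 := Real.log_two_gt_d9
  have hlog4 : Real.log (4 : ℕ) = 2 * Real.log 2 := by
    rw [show ((4 : ℕ) : ℝ) = 2 ^ 2 by norm_num, Real.log_pow]; norm_num
  rw [hlog4] at h4
  have a0 : (0 : ℝ) ≤ Nat.log 2 T := by positivity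
  have b0 : (0 : ℝ) ≤ Nat.log 4 T := by positivity
  have a1 : (Nat.log 2 T : ℝ) ≤ 2 * Real.log T := by push_cast at h2; nlinarith
  have b1 : (Nat.log 4 T : ℝ) ≤ Real.log T := by nlinarith
  have : ((Nat.log 2 T : ℝ) + 1) * Nat.log 4 T ≤ (2 * Real.log T + 1) * Real.log T := by gcongr
  unfold blockCount
  push_cast
  nlinarith

/-- A common bound of all logarithmic factors. -/
def logBound (C : ℝ) (p T : ℕ) : ℝ := 80 * (C + 1) * (1 + Real.log T) ^ (p + 2)

lemma accuracyFactor_le (hC : 0 < C) (hT : 1 ≤ T) :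
    10 * accuracyFactor C p T ≤ logBound C p T := by
  have hl := one_le_one_add_log hT
  set l := 1 + Real.log T with hl_def
  have h1 : 1 ≤ l ^ p := one_le_pow₀ hl
  have h2 : l ^ (p + 2) = l ^ p * l * l := by ring
  have h3 : l ^ p ≤ l ^ p * l := le_mul_of_one_le_right (by positivity) hl
  have h4 : l ^ p * l ≤ l ^ p * l * l := le_mul_of_one_le_right (by positivity) hl
  have h5 : l ≤ l ^ p * l := le_mul_of_one_le_left (by positivity) h1
  unfold accuracyFactor regretFactor logBound
  rw [← hl_def, h2]
  nlinarith

lemma blockCount_le_logBound (hC : 0 < C) (hT : 1 ≤ T) :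
    (blockCount T : ℝ) + 1 ≤ logBound C p T := by
  have hl := one_le_one_add_log hT
  refine (blockCount_add_one_le hT).trans ?_
  unfold logBound
  rw [pow_add]
  have h1 : 1 ≤ (1 + Real.log T) ^ p := one_le_pow₀ hl
  have h2 : (1 + Real.log T) ^ 2 ≤ (1 + Real.log T) ^ p * (1 + Real.log T) ^ 2 :=
    le_mul_of_one_le_left (by positivity) h1
  have h3 : 2 * ((1 + Real.log T) ^ p * (1 + Real.log T) ^ 2) ≤
      80 * (C + 1) * ((1 + Real.log T) ^ p * (1 + Real.log T) ^ 2) := by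
    gcongr
    linarith
  linarith

end Constants

/-! ### The concrete parameters satisfy the calibration. -/

section Calibration

variable {X : Type u} {A : Type v} [MeasurableSpace X] [MeasurableSpace A] {K : ℕ} {d : Fin K → ℕ}
  (P : Problem X A d) (L : Fin K → BaseLearner.{u, v, w} X A)

namespace Problem

/-- The arm of the smallest well-specified base learner. -/
def bestArm (α : ℝ) : ℕ := sInf {b | (d P.iStar : ℝ) ^ α < 2 ^ (b + 1)}

lemma lt_two_pow_bestArm (α : ℝ) : (d P.iStar : ℝ) ^ α < 2 ^ (P.bestArm α + 1) :=
  Nat.sInf_mem (s := {b | (d P.iStar : ℝ) ^ α < 2 ^ (b + 1)}) (exists_lt_two_pow_succ _)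

lemma two_pow_bestArm_le {α : ℝ} (h : 0 < P.bestArm α) :
    2 ^ P.bestArm α ≤ (d P.iStar : ℝ) ^ α := by
  by_contra hlt
  have := Nat.sInf_le (s := {b | (d P.iStar : ℝ) ^ α < 2 ^ (b + 1)}) (m := P.bestArm α - 1) (by
    simp only [Set.mem_ofPred_eq, Nat.sub_add_cancel h]
    exact not_le.1 hlt)
  unfold bestArm at *
  omega

lemma firstArm_le_bestArm (α : ℝ) : firstArm α d ≤ P.bestArm α :=
  Nat.sInf_le ⟨P.iStar, P.lt_two_pow_bestArm α⟩

lemma lt_two_pow_of_bestArm_le {α : ℝ} {j : ℕ} (hj : P.bestArm α ≤ j) :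
    (d P.iStar : ℝ) ^ α < 2 ^ (j + 1) :=
  (P.lt_two_pow_bestArm α).trans_le (pow_le_pow_right₀ one_le_two (Nat.succ_le_succ hj))

/-- Otherwise monotone dimensions would give `d iStar ^ α < 2 ^ (j + 1) ≤ 2 ^ bestArm ≤ d iStar ^
α`. -/
lemma armLearner_lt_iStar {α : ℝ} (hα : 0 ≤ α) (hK : 0 < K) {j : ℕ} (hj : firstArm α d ≤ j)
    (hjk : j < P.bestArm α) : armLearner α hK d j < P.iStar := by
  by_contra hle
  have h1 := armLearner_lt_of_firstArm_le hK d hj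
  have h2 := P.two_pow_bestArm_le (α := α) (by omega)
  have h3 : (d P.iStar : ℝ) ≤ d (armLearner α hK d j) := by exact_mod_cast P.dim_mono (not_lt.1 hle)
  have h4 : (d P.iStar : ℝ) ^ α ≤ (d (armLearner α hK d j) : ℝ) ^ α :=
    Real.rpow_le_rpow (by positivity) h3 hα
  have h5 : (2 : ℝ) ^ (j + 1) ≤ 2 ^ P.bestArm α := pow_le_pow_right₀ one_le_two hjk
  linarith

end Problem

variable {P L}

lemma calibrated_config {α C : ℝ} {p T : ℕ} (hC : 0 < C) (hT : 1 ≤ T) (hK : 0 < K)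
    (hL : ∀ i, P.iStar ≤ i → ∀ t ≤ T,
      soloRegret P i (L i) t ≤ C * (d i : ℝ) ^ α * √t * (1 + Real.log T) ^ p) :
    Calibrated P L (config α C p T hK d) T (P.bestArm α) (blockCount T) (regretFactor C p T)
      (2 ^ explorationExponent C p T) (1 + Real.log T) where
  one_le_T := hT
  one_le_C := by linarith [three_le_regretFactor (p := p) hC hT]
  one_le_R := one_le_pow₀ one_le_two
  l_nonneg := by linarith [one_le_one_add_log hT]
  copies_pos := Nat.succ_pos _
  le_two_pow_copies := by exact_mod_cast (Nat.lt_pow_succ_log_self one_lt_two T).le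
  copies_mul_top_le := le_rfl
  sqrt_le_two_pow := by
    refine Real.sqrt_le_iff.2 ⟨by positivity, ?_⟩
    have h : T < 4 ^ (Nat.log 4 T + 1) := Nat.lt_pow_succ_log_self (by norm_num) T
    have h' : (T : ℝ) < 4 ^ (Nat.log 4 T + 1) := by exact_mod_cast h
    have h2 : ((2 : ℝ) ^ (Nat.log 4 T + 1)) ^ 2 = 4 ^ (Nat.log 4 T + 1) := by
      rw [← pow_mul, mul_comm, pow_mul]; norm_num
    change (T : ℝ) ≤ (2 ^ (Nat.log 4 T + 1)) ^ 2
    rw [h2]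
    exact h'.le
  one_le_len := by
    intro b j hj
    refine le_min hT ((Nat.one_le_div_iff (by positivity)).2 ?_)
    have h1 : 4 ^ j ≤ T := (Nat.pow_le_pow_right (by norm_num) hj).trans
      (Nat.pow_log_le_self 4 (by omega))
    exact h1.trans (Nat.le_mul_of_pos_right _ (by positivity))
  len_le := fun _ _ => min_le_left _ _
  len_self := by
    intro b _
    refine min_eq_left ?_
    rw [pow_add, mul_left_comm, Nat.mul_div_cancel_left _ (by positivity)]
    exact Nat.le_mul_of_pos_right _ (by positivity)
  mul_sqrt_len_le := by
    intro b j _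
    set μ := explorationExponent C p T
    set N := (config α C p T hK d).len b j with hN
    have h1 : N * 4 ^ j ≤ T * 4 ^ (b + μ) :=
      (Nat.mul_le_mul_right _ (min_le_right _ _)).trans (Nat.div_mul_le_self _ _)
    have h2 : (N : ℝ) * 4 ^ j ≤ T * 4 ^ (b + μ) := by exact_mod_cast h1
    have hp : ∀ n : ℕ, ((2 : ℝ) ^ n) ^ 2 = 4 ^ n := fun n => by
      rw [← pow_mul, mul_comm, pow_mul]; norm_num
    refine le_of_sq_le_sq ?_ (by positivity)
    rw [mul_pow, mul_pow, mul_pow, Real.sq_sqrt (by positivity), Real.sq_sqrt (by positivity), hp,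
      hp, hp]
    rw [pow_add] at h2
    linarith
  thr_eq := fun _ => rfl
  conf_nonneg := by
    change 0 ≤ 1 + Real.log T + 1
    linarith [one_le_one_add_log hT]
  tail_le := by
    change T * Real.exp ((1 + Real.log T) ^ 2 - (1 + Real.log T) * (1 + Real.log T + 1)) ≤ 1
    have hT' : (0 : ℝ) < T := by exact_mod_cast hT
    -- With `l = 1 + log T` and `conf = l + 1` the exponent is `-l`, which beats the factor `T`.
    have h1 : (1 + Real.log T) ^ 2 - (1 + Real.log T) * (1 + Real.log T + 1) =
        -Real.log T + -1 := by ring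
    rw [h1, Real.exp_add, Real.exp_neg, Real.exp_log hT', ← mul_assoc, mul_inv_cancel₀ hT'.ne',
      one_mul]
    exact Real.exp_le_one_iff.2 (by norm_num)
  wellSpecified := fun j hj => le_armLearner hK d (P.lt_two_pow_of_bestArm_le hj)
  -- The `2 * C` in `regretFactor` accounts for the dyadic range up to `2 ^ (j + 1)`, the 3 for the
  -- exponential correction.
  soloRegret_le := by
    intro j hj t ht
    have hlt := P.lt_two_pow_of_bestArm_le hj
    have h1 := hL _ (le_armLearner hK d hlt) t ht
    have h2 := (armLearner_lt hK d hlt).le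
    have hl := one_le_one_add_log hT
    have h3 : C * (d (armLearner α hK d j) : ℝ) ^ α * √t * (1 + Real.log T) ^ p ≤
        C * 2 ^ (j + 1) * √t * (1 + Real.log T) ^ p := by gcongr
    have h4 : (1 : ℝ) ≤ 2 ^ j := one_le_pow₀ one_le_two
    have h5 : 3 * √(t : ℝ) ≤ 3 * 2 ^ j * √t := by
      gcongr
      linarith
    change soloRegret P (armLearner α hK d j) (L (armLearner α hK d j)) t + 3 * √t ≤ _
    unfold regretFactor
    rw [pow_succ] at h3
    linarith

lemma le_roundRegret {i : Fin K} {δ : ℝ} (h : ∀ x a, δ ≤ P.mean i x a - P.best x)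
    (s : (L i).State) : δ ≤ roundRegret P i (L i) s := by
  have h1 := integral_mono (μ := soloPlay P (L i) s) (integrable_const δ)
    (integrable_of_abs_le (measurable_mean_sub_best P i) fun _ => P.abs_mean_sub_best_le i _ _)
    fun z => h z.1 z.2
  simpa [roundRegret] using h1

/-- The accuracy of the bound of the optimal value, after the exploration of the arm `k`. -/
lemma accuracy_le (α : ℝ) {C : ℝ} {p T : ℕ} (hC : 0 < C) (hT : 1 ≤ T) (hK : 0 < K) {b k : ℕ}
    (hk : k ≤ Nat.log 4 T) :
    (2 * (regretFactor C p T * 2 ^ k) + (config α C p T hK d).conf) /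
        √((config α C p T hK d).len b k) * √T ≤
      accuracyFactor C p T * 2 ^ k +
        2 * accuracyFactor C p T * 4 ^ k / (2 ^ b * 2 ^ explorationExponent C p T) := by
  set μ := explorationExponent C p T
  set N := (config α C p T hK d).len b k with hN
  have hT' : (0 : ℝ) < T := by exact_mod_cast hT
  have hA := (three_le_regretFactor (p := p) hC hT).trans (regretFactor_le_accuracyFactor hC hT)
  have h4k : 4 ^ k ≤ T := (Nat.pow_le_pow_right (by norm_num) hk).trans
    (Nat.pow_log_le_self 4 (by omega))
  have hdiv : 1 ≤ T * 4 ^ (b + μ) / 4 ^ k := (Nat.one_le_div_iff (by positivity)).2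
    (h4k.trans (Nat.le_mul_of_pos_right _ (by positivity)))
  have hN1 : 1 ≤ N := le_min hT hdiv
  have hN' : (0 : ℝ) < N := by exact_mod_cast hN1
  have hsN : 0 < √(N : ℝ) := Real.sqrt_pos.2 hN'
  have hp : ∀ n : ℕ, ((2 : ℝ) ^ n) ^ 2 = 4 ^ n := fun n => by
    rw [← pow_mul, mul_comm, pow_mul]; norm_num
  have hratio : √T / √(N : ℝ) ≤ 1 + 2 * 2 ^ k / (2 ^ b * 2 ^ μ) := by
    rcases min_choice T (T * 4 ^ (b + μ) / 4 ^ k) with h | h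
    · have hNT : N = T := h
      rw [hNT, div_self (Real.sqrt_pos.2 hT').ne']
      have : (0 : ℝ) ≤ 2 * 2 ^ k / (2 ^ b * 2 ^ μ) := by positivity
      linarith
    · have hNd : N = T * 4 ^ (b + μ) / 4 ^ k := h
      -- The integer quotient loses at most a factor 2 because `N ≥ 1`; this is covered by the 2 in
      -- `hratio`.
      have h1 : T * 4 ^ (b + μ) < (N + 1) * 4 ^ k := by
        have := Nat.lt_mul_div_succ (T * 4 ^ (b + μ)) (show 0 < 4 ^ k by positivity)
        rw [← hNd] at this
        linarith
      have h2 : (T : ℝ) * 4 ^ (b + μ) < (N + 1) * 4 ^ k := by exact_mod_cast h1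
      have hN1' : (1 : ℝ) ≤ N := by exact_mod_cast hN1
      have h3 : √T * (2 ^ b * 2 ^ μ) ≤ 2 * 2 ^ k * √(N : ℝ) := by
        refine le_of_sq_le_sq ?_ (by positivity)
        rw [mul_pow, mul_pow, mul_pow, mul_pow, Real.sq_sqrt hT'.le, Real.sq_sqrt hN'.le, hp, hp,
          hp, ← pow_add]
        have h4 : (0 : ℝ) < 4 ^ k := by positivity
        nlinarith
      have h4 : √T / √(N : ℝ) ≤ 2 * 2 ^ k / (2 ^ b * 2 ^ μ) := by
        rw [div_le_div_iff₀ hsN (by positivity)]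
        exact h3
      linarith
  have hnum : 2 * (regretFactor C p T * 2 ^ k) + (config α C p T hK d).conf ≤
      accuracyFactor C p T * 2 ^ k := by
    change 2 * (regretFactor C p T * 2 ^ k) + (1 + Real.log T + 1) ≤ _
    have h1 : (1 : ℝ) ≤ 2 ^ k := one_le_pow₀ one_le_two
    have h2 := one_le_one_add_log hT
    unfold accuracyFactor
    nlinarith
  calc _ = (2 * (regretFactor C p T * 2 ^ k) + (config α C p T hK d).conf) * (√T / √N) := by ring
    _ ≤ accuracyFactor C p T * 2 ^ k * (1 + 2 * 2 ^ k / (2 ^ b * 2 ^ μ)) := by gcongr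
    _ = _ := by
      rw [← hp k]
      ring

end Calibration

/-! ### Drift of the misspecified arms, and the regret bounds. -/

section Regret

variable {X : Type u} {A : Type v} [MeasurableSpace X] [MeasurableSpace A] {K : ℕ} {d : Fin K → ℕ}
  {P : Problem X A d} {L : Fin K → BaseLearner.{u, v, w} X A}

lemma two_pow_le_four_pow (k : ℕ) : (2 : ℝ) ^ k ≤ 4 ^ k :=
  pow_le_pow_left₀ (by norm_num) (by norm_num) k

lemma thirty_le_logBound {C : ℝ} {p T : ℕ} (hC : 0 < C) (hT : 1 ≤ T) : 30 ≤ logBound C p T := by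
  linarith [three_le_regretFactor (p := p) hC hT, regretFactor_le_accuracyFactor (p := p) hC hT,
    accuracyFactor_le (p := p) hC hT]

lemma thr_config_le {α C : ℝ} {p T : ℕ} (hC : 0 < C) (hT : 1 ≤ T) (hK : 0 < K) {j k : ℕ}
    (hjk : j < k) :
    (config α C p T hK d).thr j ≤ logBound C p T ^ 3 / 5 * (2 ^ k * √T) := by
  have h1 := three_le_regretFactor (p := p) hC hT
  have h2 := regretFactor_le_accuracyFactor (p := p) hC hT
  have h3 := two_pow_explorationExponent_le (p := p) hC hT
  have h4 := accuracyFactor_le (p := p) hC hT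
  have h5 := blockCount_le_logBound (p := p) hC hT
  have h6 : (2 : ℝ) ^ (j + 1) ≤ 2 ^ k := pow_le_pow_right₀ one_le_two hjk
  have hZ := thirty_le_logBound (p := p) hC hT
  have h7 : regretFactor C p T ≤ logBound C p T / 10 := by linarith
  have h8 := h3.trans h4
  calc (config α C p T hK d).thr j = 2 ^ (j + 1) * (2 * ((blockCount T : ℝ) + 1) *
      (regretFactor C p T * 2 ^ explorationExponent C p T)) * √T := rfl
    _ ≤ 2 ^ k * (2 * logBound C p T * (logBound C p T / 10 * logBound C p T)) * √T := by
      have : 0 ≤ logBound C p T := by linarith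
      have : 0 ≤ regretFactor C p T := by linarith
      gcongr
    _ = _ := by ring

/-- There are at most logarithmically many phases and blocks, so the bound per misspecified block
determines the order. `D` will be `2 ^ bestArm` or its square. -/
lemma corralRegret_le_of_drift {α C : ℝ} {p T : ℕ} (hC : 0 < C) (hT : 1 ≤ T) (hK : 0 < K)
    (hL : ∀ i, P.iStar ≤ i → ∀ t ≤ T,
      soloRegret P i (L i) t ≤ C * (d i : ℝ) ^ α * √t * (1 + Real.log T) ^ p)
    (hk : P.bestArm α ≤ Nat.log 4 T) {D : ℝ} (hD : 2 ^ P.bestArm α ≤ D)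
    (hmis : ∀ b j, firstArm α d ≤ b → b ≤ j → j < P.bestArm α → ∃ a e, 0 ≤ a ∧ 0 ≤ e ∧
      (∀ s, roundRegret P (armLearner α hK d j) (L (armLearner α hK d j)) s ≤
        a * (roundRegret P (armLearner α hK d j) (L (armLearner α hK d j)) s -
          (2 * (regretFactor C p T * 2 ^ P.bestArm α) + (config α C p T hK d).conf) /
            √((config α C p T hK d).len b (P.bestArm α))) + e) ∧
      a * (config α C p T hK d).thr j + 21 * a * √T + (config α C p T hK d).len b j * e ≤
        logBound C p T ^ 4 * (D * √T)) :
    corralRegret P L (config α C p T hK d).rule.strategy T ≤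
      2 * logBound C p T ^ 6 * (D * √T) := by
  set k := P.bestArm α
  have hcal := calibrated_config (P := P) (L := L) hC hT hK hL
  have hZ := thirty_le_logBound (p := p) hC hT
  have hA2 := three_le_regretFactor (p := p) hC hT
  have hA1 := regretFactor_le_accuracyFactor (p := p) hC hT
  have hR := (two_pow_explorationExponent_le (p := p) hC hT).trans (accuracyFactor_le hC hT)
  have hA3 := accuracyFactor_le (p := p) hC hT
  have hQ := blockCount_le_logBound (p := p) hC hT
  have hs := hcal.one_le_sqrt
  have h2k : (1 : ℝ) ≤ 2 ^ k := one_le_pow₀ one_le_two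
  set Z := logBound C p T
  set y := D * √T with hy
  have hDs : 2 ^ k * √T ≤ y := mul_le_mul_of_nonneg_right hD (Real.sqrt_nonneg _)
  have hy1 : 1 ≤ y := (one_le_mul_of_one_le_of_one_le h2k hs).trans hDs
  have hkQ : ((k - firstArm α d : ℕ) : ℝ) ≤ Z := by
    have h1 : k - firstArm α d ≤ blockCount T :=
      (Nat.sub_le _ _).trans (hk.trans (Nat.le_mul_of_pos_left _ (Nat.succ_pos _)))
    have h2 : ((k - firstArm α d : ℕ) : ℝ) ≤ blockCount T := by exact_mod_cast h1
    linarith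
  have hmain := hcal.restartValue_phaseStart_le hk (M := Z ^ 4 * y) (by positivity) hmis
    (firstArm α d) le_rfl (P.firstArm_le_bestArm α) T le_rfl
  rw [corralRegret_strategy]
  refine hmain.trans ?_
  have hAR : regretFactor C p T * 2 ^ explorationExponent C p T + 1 ≤ Z ^ 2 / 5 := by
    have h1 : regretFactor C p T * 2 ^ explorationExponent C p T ≤ Z / 10 * Z := by
      gcongr
      linarith
    nlinarith
  have hE : 2 * ((blockCount T : ℝ) + 1) *
      (regretFactor C p T * 2 ^ explorationExponent C p T + 1) * 2 ^ k * √T ≤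
      2 * Z * (Z ^ 2 / 5) * y := by
    rw [mul_assoc _ (2 ^ k)]
    gcongr
  set E := 2 * ((blockCount T : ℝ) + 1) *
      (regretFactor C p T * 2 ^ explorationExponent C p T + 1) * 2 ^ k * √T
  have hE0 : 0 ≤ E := by positivity
  have hZp : ∀ m : ℕ, m ≤ 5 → 30 * Z ^ m * y ≤ Z ^ 6 * y := fun m hm => by
    gcongr
    calc 30 * Z ^ m ≤ Z * Z ^ 5 := by
          gcongr
          linarith
      _ = Z ^ 6 := by ring
  have h1 : ((k - firstArm α d : ℕ) : ℝ) * (E + (blockCount T + 1) * (Z ^ 4 * y) + 1) ≤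
      Z * (2 * Z * (Z ^ 2 / 5) * y + Z * (Z ^ 4 * y) + y) := by
    gcongr
  have e3 := hZp 3 (by norm_num)
  have e4 := hZp 4 (by norm_num)
  have e1 := hZp 1 (by norm_num)
  linarith

/-- For the arm just below the best one, where the gap may vanish. Where `1 / √N` makes the accuracy
poor in early phases, the block of arm `k` is short as well, and `2 ^ b * R` cancels. -/
lemma len_mul_accuracy_le {α C : ℝ} {p T : ℕ} (hC : 0 < C) (hT : 1 ≤ T) (hK : 0 < K)
    (hL : ∀ i, P.iStar ≤ i → ∀ t ≤ T,
      soloRegret P i (L i) t ≤ C * (d i : ℝ) ^ α * √t * (1 + Real.log T) ^ p)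
    {b k : ℕ} (hk : k + 1 ≤ Nat.log 4 T) :
    (config α C p T hK d).len b k * ((2 * (regretFactor C p T * 2 ^ (k + 1)) +
      (config α C p T hK d).conf) / √((config α C p T hK d).len b (k + 1))) ≤
      5 * accuracyFactor C p T * (2 ^ (k + 1) * √T) := by
  have hcal := calibrated_config (P := P) (L := L) hC hT hK hL
  have hacc := accuracy_le (d := d) α (p := p) hC hT hK (b := b) hk
  set ε := (2 * (regretFactor C p T * 2 ^ (k + 1)) +
      (config α C p T hK d).conf) / √((config α C p T hK d).len b (k + 1))
  set N := (config α C p T hK d).len b k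
  set R := (2 : ℝ) ^ explorationExponent C p T
  have hs : 0 < √(T : ℝ) := by linarith [hcal.one_le_sqrt]
  have hss : √(T : ℝ) * √T = T := Real.mul_self_sqrt (by positivity)
  have hN : √(N : ℝ) ≤ √T := Real.sqrt_le_sqrt (by exact_mod_cast hcal.len_le b k)
  have hNT : (N : ℝ) ≤ T := by exact_mod_cast hcal.len_le b k
  have h1 : 2 ^ k * √(N : ℝ) ≤ R * 2 ^ b * √T := hcal.mul_sqrt_len_le b k (by
    change k ≤ Nat.log 4 T
    omega)
  have hA : 0 < accuracyFactor C p T := by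
    linarith [three_le_regretFactor (p := p) hC hT, regretFactor_le_accuracyFactor (p := p) hC hT]
  have hb : (0 : ℝ) < 2 ^ b * R := by positivity
  have h2 : (N : ℝ) * 2 ^ k / (2 ^ b * R) ≤ T := by
    rw [div_le_iff₀ hb]
    calc (N : ℝ) * 2 ^ k = √N * (2 ^ k * √N) := by
          linear_combination -(2 : ℝ) ^ k * Real.mul_self_sqrt (Nat.cast_nonneg (α := ℝ) N)
      _ ≤ √T * (R * 2 ^ b * √T) := by gcongr
      _ = T * (2 ^ b * R) := by linear_combination (R * 2 ^ b) * hss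
  have h4 : (4 : ℝ) ^ (k + 1) = 2 ^ (k + 1) * (2 * 2 ^ k) := by
    rw [← pow_succ', ← mul_pow]; norm_num
  refine le_of_mul_le_mul_right ?_ hs
  calc N * ε * √T = N * (ε * √T) := by ring
    _ ≤ N * (accuracyFactor C p T * 2 ^ (k + 1) +
        2 * accuracyFactor C p T * 4 ^ (k + 1) / (2 ^ b * R)) := by gcongr
    _ = accuracyFactor C p T * 2 ^ (k + 1) * N +
        4 * accuracyFactor C p T * 2 ^ (k + 1) * (N * 2 ^ k / (2 ^ b * R)) := by
      rw [h4]; ring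
    _ ≤ accuracyFactor C p T * 2 ^ (k + 1) * T + 4 * accuracyFactor C p T * 2 ^ (k + 1) * T := by
      gcongr
    _ = _ := by
      linear_combination -(5 * accuracyFactor C p T * 2 ^ (k + 1)) * hss

/-- Without a gap `a = 1` and `e = ε` make the drift condition an identity. The price is a length at
most `T` times `ε`, the source of the factor `4 ^ k`. -/
lemma exists_drift {α C : ℝ} {p T : ℕ} (hC : 0 < C) (hT : 1 ≤ T) (hK : 0 < K)
    (hL : ∀ i, P.iStar ≤ i → ∀ t ≤ T,
      soloRegret P i (L i) t ≤ C * (d i : ℝ) ^ α * √t * (1 + Real.log T) ^ p)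
    {k : ℕ} (hk : k ≤ Nat.log 4 T) {b j : ℕ} (hjk : j < k) :
    ∃ a e, 0 ≤ a ∧ 0 ≤ e ∧
      (∀ s, roundRegret P (armLearner α hK d j) (L (armLearner α hK d j)) s ≤
        a * (roundRegret P (armLearner α hK d j) (L (armLearner α hK d j)) s -
          (2 * (regretFactor C p T * 2 ^ k) + (config α C p T hK d).conf) /
            √((config α C p T hK d).len b k)) + e) ∧
      a * (config α C p T hK d).thr j + 21 * a * √T + (config α C p T hK d).len b j * e ≤
        logBound C p T ^ 3 * (4 ^ k * √T) := by
  have hcal := calibrated_config (P := P) (L := L) hC hT hK hL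
  have hacc := accuracy_le (d := d) α (p := p) hC hT hK (b := b) hk
  have hthr := thr_config_le (d := d) (α := α) (p := p) hC hT hK hjk
  have hA2 := three_le_regretFactor (p := p) hC hT
  have hconf := hcal.conf_nonneg
  have hA1 := regretFactor_le_accuracyFactor (p := p) hC hT
  have hA3 := accuracyFactor_le (p := p) hC hT
  have hZ := thirty_le_logBound (p := p) hC hT
  have hs : 1 ≤ √(T : ℝ) := hcal.one_le_sqrt
  have hss : √(T : ℝ) * √T = T := Real.mul_self_sqrt (by positivity)
  have hε : 0 ≤ (2 * (regretFactor C p T * 2 ^ k) + (config α C p T hK d).conf) /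
      √((config α C p T hK d).len b k) := by
    have : 0 ≤ regretFactor C p T := by linarith
    positivity
  refine ⟨1, _, zero_le_one, hε, fun s => by linarith, ?_⟩
  set ε := (2 * (regretFactor C p T * 2 ^ k) + (config α C p T hK d).conf) /
      √((config α C p T hK d).len b k)
  have h24 := two_pow_le_four_pow k
  set Z := logBound C p T
  have h4k : (1 : ℝ) ≤ 4 ^ k := one_le_pow₀ (by norm_num)
  have hx : (1 : ℝ) ≤ 2 ^ b * 2 ^ explorationExponent C p T :=
    one_le_mul_of_one_le_of_one_le (one_le_pow₀ one_le_two) (one_le_pow₀ one_le_two)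
  have h1 : ε * √T ≤ 3 * accuracyFactor C p T * 4 ^ k := by
    have h2 : 2 * accuracyFactor C p T * 4 ^ k / (2 ^ b * 2 ^ explorationExponent C p T) ≤
        2 * accuracyFactor C p T * 4 ^ k := by
      refine div_le_self ?_ hx
      have : 0 ≤ accuracyFactor C p T := by linarith
      positivity
    have h3 : accuracyFactor C p T * 2 ^ k ≤ accuracyFactor C p T * 4 ^ k := by
      gcongr
      linarith
    linarith
  have h2 : (config α C p T hK d).len b j * ε ≤ 3 * accuracyFactor C p T * (4 ^ k * √T) := by
    calc (config α C p T hK d).len b j * ε ≤ T * ε := by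
          gcongr
          exact_mod_cast hcal.len_le b j
      _ = ε * √T * √T := by rw [mul_assoc, hss, mul_comm]
      _ ≤ 3 * accuracyFactor C p T * 4 ^ k * √T := by gcongr
      _ = _ := by ring
  set y := (4 : ℝ) ^ k * √T with hy
  have h3 : √T ≤ y := le_mul_of_one_le_left (by positivity) h4k
  have h4 : 2 ^ k * √T ≤ y := mul_le_mul_of_nonneg_right h24 (Real.sqrt_nonneg _)
  have h5 : Z ^ 3 / 5 * (2 ^ k * √T) ≤ Z ^ 3 / 5 * y := by gcongr
  have h6 : 3 * accuracyFactor C p T * y ≤ Z * y := by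
    gcongr
    linarith
  have h7 : 30 * 30 * Z * y ≤ Z ^ 3 * y := by
    gcongr
    calc 30 * 30 * Z ≤ Z * Z * Z := by gcongr
      _ = Z ^ 3 := by ring
  have h8 : 30 * y ≤ Z * y := by gcongr
  linarith

lemma exists_drift_of_gap {α C : ℝ} {p T : ℕ} (hα : 0 ≤ α) (hC : 0 < C) (hT : 1 ≤ T) (hK : 0 < K)
    (hL : ∀ i, P.iStar ≤ i → ∀ t ≤ T,
      soloRegret P i (L i) t ≤ C * (d i : ℝ) ^ α * √t * (1 + Real.log T) ^ p)
    (hgap : P.Gap α T) (hk : P.bestArm α ≤ Nat.log 4 T) {b j : ℕ} (hb : firstArm α d ≤ b)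
    (hbj : b ≤ j) (hjk : j < P.bestArm α) :
    ∃ a e, 0 ≤ a ∧ 0 ≤ e ∧
      (∀ s, roundRegret P (armLearner α hK d j) (L (armLearner α hK d j)) s ≤
        a * (roundRegret P (armLearner α hK d j) (L (armLearner α hK d j)) s -
          (2 * (regretFactor C p T * 2 ^ P.bestArm α) + (config α C p T hK d).conf) /
            √((config α C p T hK d).len b (P.bestArm α))) + e) ∧
      a * (config α C p T hK d).thr j + 21 * a * √T + (config α C p T hK d).len b j * e ≤
        logBound C p T ^ 4 * (2 ^ P.bestArm α * √T) := by
  have hdim := P.two_pow_bestArm_le (α := α) (by omega)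
  have hlt := P.armLearner_lt_iStar hα hK (hb.trans hbj) hjk
  have hdj := armLearner_lt_of_firstArm_le hK d (hb.trans hbj)
  have hcal := calibrated_config (P := P) (L := L) hC hT hK hL
  have hA2 := three_le_regretFactor (p := p) hC hT
  have hA1 := regretFactor_le_accuracyFactor (p := p) hC hT
  have hA3 := accuracyFactor_le (p := p) hC hT
  have hZ := thirty_le_logBound (p := p) hC hT
  have hs : 1 ≤ √(T : ℝ) := hcal.one_le_sqrt
  have hconf := hcal.conf_nonneg
  have hthr := thr_config_le (d := d) (α := α) (p := p) hC hT hK hjk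
  set k := P.bestArm α
  have h2k : (1 : ℝ) ≤ 2 ^ k := one_le_pow₀ one_le_two
  have h44 : (4 : ℝ) ^ k = 2 ^ k * 2 ^ k := by rw [← mul_pow]; norm_num
  have hy : √T ≤ 2 ^ k * √T := le_mul_of_one_le_left (by positivity) h2k
  have hZ3 : (30 : ℝ) ^ 3 ≤ logBound C p T ^ 3 := by gcongr
  have hZ4 : logBound C p T ^ 3 * 30 ≤ logBound C p T ^ 4 := by
    rw [pow_succ _ 3]
    gcongr
  -- If `2 ^ k` is below a logarithmic factor, `4 ^ k` and `2 ^ k` agree up to logarithms and no gap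
  -- is needed.
  rcases lt_or_ge ((2 : ℝ) ^ k) (4 * accuracyFactor C p T) with hsmall | hlarge
  · obtain ⟨a, e, ha, he, h1, h2⟩ := exists_drift (P := P) hC hT hK hL hk (b := b) hjk
    refine ⟨a, e, ha, he, h1, h2.trans ?_⟩
    calc logBound C p T ^ 3 * (4 ^ k * √T) = logBound C p T ^ 3 * 2 ^ k * (2 ^ k * √T) := by
          rw [h44]; ring
      _ ≤ logBound C p T ^ 3 * logBound C p T * (2 ^ k * √T) := by
          gcongr
          linarith
      _ = _ := by ring
  · have hε : 0 ≤ (2 * (regretFactor C p T * 2 ^ k) + (config α C p T hK d).conf) /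
        √((config α C p T hK d).len b k) := by
      have : 0 ≤ regretFactor C p T := by linarith
      positivity
    rcases Nat.lt_or_ge (j + 1) k with hj | hj
    -- A round regret of at least `2 * ε` is at most twice its excess over `ε`, hence `a = 2` and `e
    -- = 0`.
    · refine ⟨2, 0, by norm_num, le_rfl, fun s => ?_, ?_⟩
      · have hδ := le_roundRegret (L := L) (hgap _ hlt) s
        have hacc := accuracy_le (d := d) α (p := p) hC hT hK (b := b) hk
        set ε := (2 * (regretFactor C p T * 2 ^ k) + (config α C p T hK d).conf) /
          √((config α C p T hK d).len b k)
        set δ := 2 * ((d P.iStar : ℝ) ^ (2 * α) -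
          (d (armLearner α hK d j) : ℝ) ^ (2 * α)) / √T with hδ_def
        have hsq : ∀ n : ℕ, (n : ℝ) ^ (2 * α) = ((n : ℝ) ^ α) ^ 2 := fun n => by
          rw [mul_comm, Real.rpow_mul (by positivity)]
          norm_cast
        have h1 : 4 ^ k ≤ (d P.iStar : ℝ) ^ (2 * α) := by
          rw [hsq, h44, ← sq]
          gcongr
        have h2 : (d (armLearner α hK d j) : ℝ) ^ (2 * α) ≤ 4 ^ k / 4 := by
          have h3 : (2 : ℝ) ^ (j + 1) * 2 ≤ 2 ^ k := by
            rw [← pow_succ]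
            exact pow_le_pow_right₀ one_le_two hj
          have h4 : (d (armLearner α hK d j) : ℝ) ^ α ≤ 2 ^ k / 2 := by linarith
          rw [hsq, h44]
          calc ((d (armLearner α hK d j) : ℝ) ^ α) ^ 2 ≤ (2 ^ k / 2) ^ 2 := by gcongr
            _ = _ := by ring
        have h3 : δ * √T = 2 * ((d P.iStar : ℝ) ^ (2 * α) -
            (d (armLearner α hK d j) : ℝ) ^ (2 * α)) := div_mul_cancel₀ _ (by positivity)
        have h4 : 2 * accuracyFactor C p T * 4 ^ k / (2 ^ b * 2 ^ explorationExponent C p T) ≤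
            4 ^ k / 2 := by
          have h5 := four_mul_accuracyFactor_le (C := C) (p := p) (T := T)
          have h6 : (2 : ℝ) ^ explorationExponent C p T ≤
              2 ^ b * 2 ^ explorationExponent C p T :=
            le_mul_of_one_le_left (by positivity) (one_le_pow₀ one_le_two)
          rw [div_le_iff₀ (by positivity)]
          have h7 : 4 * accuracyFactor C p T * 4 ^ k ≤
              2 ^ b * 2 ^ explorationExponent C p T * 4 ^ k :=
            mul_le_mul_of_nonneg_right (h5.trans h6) (by positivity)
          linarith
        have h5 : accuracyFactor C p T * 2 ^ k ≤ 4 ^ k / 4 := by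
          rw [h44]
          have : 4 * accuracyFactor C p T * 2 ^ k ≤ 2 ^ k * 2 ^ k := by gcongr
          linarith
        -- The constants match: `δ * √T ≥ 2 * (1 - 1 / 4) * 4 ^ k`, and `ε * √T ≤ (1 / 4 + 1 / 2) *
        -- 4 ^ k`.
        have h6 : 2 * ε ≤ δ := by
          refine le_of_mul_le_mul_right ?_ (lt_of_lt_of_le one_pos hs)
          linarith
        linarith
      · have h1 : 0 ≤ logBound C p T ^ 3 * (2 ^ k * √T) := by positivity
        have h2 : logBound C p T ^ 3 * 30 * (2 ^ k * √T) ≤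
            logBound C p T ^ 4 * (2 ^ k * √T) := by gcongr
        have h3 : 30 ^ 3 * (2 ^ k * √T) ≤ logBound C p T ^ 3 * (2 ^ k * √T) := by gcongr
        linarith
    · refine ⟨1, _, zero_le_one, hε, fun s => by linarith, ?_⟩
      have hkj : k = j + 1 := le_antisymm hj hjk
      have hlen := len_mul_accuracy_le (P := P) hC hT hK hL (b := b) (k := j) (hkj ▸ hk)
      rw [← hkj] at hlen
      have h1 : 5 * accuracyFactor C p T * (2 ^ k * √T) ≤ logBound C p T * (2 ^ k * √T) := by
        gcongr
        linarith
      have h2 : logBound C p T ^ 3 * 30 * (2 ^ k * √T) ≤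
          logBound C p T ^ 4 * (2 ^ k * √T) := by gcongr
      have h3 : 30 ^ 3 * (2 ^ k * √T) ≤ logBound C p T ^ 3 * (2 ^ k * √T) := by gcongr
      have h4 : logBound C p T * 30 ^ 2 * (2 ^ k * √T) ≤
          logBound C p T ^ 3 * (2 ^ k * √T) := by
        gcongr
        rw [pow_succ' _ 2]
        gcongr
      linarith

lemma two_mul_logBound_pow (C : ℝ) (p T : ℕ) :
    2 * logBound C p T ^ 6 = 2 * (80 * (C + 1)) ^ 6 * (1 + Real.log T) ^ (6 * (p + 2)) := by
  rw [logBound, mul_pow, ← pow_mul, mul_comm (p + 2)]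
  ring

/-- The term with `K` is needed only for arm 0, where `d iStar ^ α` may be less than 1 or even
vanish. -/
lemma two_pow_bestArm_mul_le (α : ℝ) (hK : 0 < K) (n : ℕ) (y : ℝ) (hy : 0 ≤ y) :
    (2 ^ P.bestArm α) ^ n * y ≤ ((d P.iStar : ℝ) ^ α) ^ n * y + K * y := by
  have hK' : (1 : ℝ) ≤ K := by exact_mod_cast hK
  rcases Nat.eq_zero_or_pos (P.bestArm α) with h | h
  · rw [h, pow_zero, one_pow]
    have h1 : 0 ≤ ((d P.iStar : ℝ) ^ α) ^ n * y := by positivity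
    have h2 : 1 * y ≤ K * y := by gcongr
    linarith
  · have h1 : (2 ^ P.bestArm α) ^ n * y ≤ ((d P.iStar : ℝ) ^ α) ^ n * y := by
      gcongr
      exact P.two_pow_bestArm_le h
    have h2 : 0 ≤ K * y := by positivity
    linarith

/-- If the best arm lies beyond all explored arms, then `d iStar ^ α ≥ √T`, and the trivial bound
`T` suffices. -/
lemma horizon_le_of_log_lt_bestArm (α : ℝ) {T n : ℕ} (hT : 1 ≤ T) (hn : n ≠ 0)
    (hk : Nat.log 4 T < P.bestArm α) : T ≤ ((d P.iStar : ℝ) ^ α) ^ n * √T := by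
  have h1 := P.two_pow_bestArm_le (α := α) (by omega)
  have h2 : T < 4 ^ (Nat.log 4 T + 1) := Nat.lt_pow_succ_log_self (by norm_num) T
  have h3 : (T : ℝ) < 4 ^ (Nat.log 4 T + 1) := by exact_mod_cast h2
  have h4 : √(T : ℝ) ≤ 2 ^ (Nat.log 4 T + 1) := by
    refine Real.sqrt_le_iff.2 ⟨by positivity, h3.le.trans_eq ?_⟩
    rw [← pow_mul, mul_comm, pow_mul]
    norm_num
  have h5 : (2 : ℝ) ^ (Nat.log 4 T + 1) ≤ 2 ^ P.bestArm α := pow_le_pow_right₀ one_le_two hk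
  have h6 : √(T : ℝ) ≤ (d P.iStar : ℝ) ^ α := h4.trans (h5.trans h1)
  have h7 : 1 ≤ (d P.iStar : ℝ) ^ α := (one_le_pow₀ one_le_two).trans h1
  have h8 : (d P.iStar : ℝ) ^ α ≤ ((d P.iStar : ℝ) ^ α) ^ n := le_self_pow₀ h7 hn
  calc (T : ℝ) = √T * √T := (Real.mul_self_sqrt (by positivity)).symm
    _ ≤ _ := by
      gcongr
      exact h6.trans h8

lemma corralRegret_le_of_drift_pow {α C : ℝ} {p T n : ℕ} (hC : 0 < C) (hT : 1 ≤ T) (hK : 0 < K)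
    (hL : ∀ i, P.iStar ≤ i → ∀ t ≤ T,
      soloRegret P i (L i) t ≤ C * (d i : ℝ) ^ α * √t * (1 + Real.log T) ^ p) (hn : n ≠ 0)
    (hmis : P.bestArm α ≤ Nat.log 4 T → ∀ b j, firstArm α d ≤ b → b ≤ j → j < P.bestArm α →
      ∃ a e, 0 ≤ a ∧ 0 ≤ e ∧
      (∀ s, roundRegret P (armLearner α hK d j) (L (armLearner α hK d j)) s ≤
        a * (roundRegret P (armLearner α hK d j) (L (armLearner α hK d j)) s -
          (2 * (regretFactor C p T * 2 ^ P.bestArm α) + (config α C p T hK d).conf) /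
            √((config α C p T hK d).len b (P.bestArm α))) + e) ∧
      a * (config α C p T hK d).thr j + 21 * a * √T + (config α C p T hK d).len b j * e ≤
        logBound C p T ^ 4 * ((2 ^ P.bestArm α) ^ n * √T)) :
    corralRegret P L (config α C p T hK d).rule.strategy T ≤ 2 * (80 * (C + 1)) ^ 6 *
      (((d P.iStar : ℝ) ^ α) ^ n * √T + K * √T) * (1 + Real.log T) ^ (6 * (p + 2)) := by
  have hZ := thirty_le_logBound (p := p) hC hT
  have hZ6 : 1 ≤ 2 * logBound C p T ^ 6 := by
    have : 1 ≤ logBound C p T ^ 6 := one_le_pow₀ (by linarith)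
    linarith
  rw [mul_right_comm, ← two_mul_logBound_pow]
  rcases le_or_gt (P.bestArm α) (Nat.log 4 T) with hk | hk
  · refine (corralRegret_le_of_drift hC hT hK hL hk (le_self_pow₀ (one_le_pow₀ one_le_two) hn)
      (hmis hk)).trans ?_
    gcongr
    exact two_pow_bestArm_mul_le α hK n _ (Real.sqrt_nonneg _)
  · have h1 := horizon_le_of_log_lt_bestArm α hT hn hk
    have h2 : 0 ≤ K * √(T : ℝ) := by positivity
    rw [corralRegret_strategy]
    refine (restartValue_le P L _ T _).trans ?_
    calc (T : ℝ) ≤ ((d P.iStar : ℝ) ^ α) ^ n * √T + K * √T := by linarith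
      _ ≤ _ := le_mul_of_one_le_left (by positivity) hZ6

end Regret

end ModelSelection

end

theorem theorem7 (α : ℝ) (hα : 0 ≤ α) (C : ℝ) (hC : 0 < C) (p : ℕ) :
    ∃ (C' : ℝ) (p' : ℕ), ∀ (T K : ℕ) (d : Fin K → ℕ), 0 < K →
      ∃ S : ModelSelection.Strategy K,
        ∀ (X : Type u) (A : Type v) [MeasurableSpace X] [MeasurableSpace A]
          (P : ModelSelection.Problem X A d)
          (L : Fin K → ModelSelection.BaseLearner.{u, v, w} X A),
          (∀ i, P.iStar ≤ i → ∀ t ≤ T,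
            ModelSelection.soloRegret P i (L i) t
              ≤ C * (d i : ℝ) ^ α * √t * (1 + Real.log T) ^ p) →
          ModelSelection.corralRegret P L S T
              ≤ C' * ((d P.iStar : ℝ) ^ (2 * α) * √T + K * √T) * (1 + Real.log T) ^ p' ∧
          (P.Gap α T →
            ModelSelection.corralRegret P L S T
              ≤ C' * ((d P.iStar : ℝ) ^ α * √T + K * √T) * (1 + Real.log T) ^ p') := by
  refine ⟨2 * (80 * (C + 1)) ^ 6, 6 * (p + 2), fun T K d hK =>
    ⟨(ModelSelection.config α C p T hK d).rule.strategy, fun X A _ _ P L hL => ?_⟩⟩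
  rcases Nat.eq_zero_or_pos T with rfl | hT
  · simp [ModelSelection.corralRegret]
  constructor
  · have h := ModelSelection.corralRegret_le_of_drift_pow hC hT hK hL two_ne_zero
      fun hk b j _ _ hjk => ?_
    · rwa [← Real.rpow_natCast ((d P.iStar : ℝ) ^ α) 2, ← Real.rpow_mul (by positivity),
        mul_comm α] at h
    · obtain ⟨a, e, ha, he, h1, h2⟩ :=
        ModelSelection.exists_drift hC hT hK hL hk (b := b) hjk
      refine ⟨a, e, ha, he, h1, h2.trans ?_⟩
      have hZ := ModelSelection.thirty_le_logBound (p := p) hC hT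
      have h4 : ((2 : ℝ) ^ P.bestArm α) ^ 2 = 4 ^ P.bestArm α := by
        rw [← pow_mul, mul_comm, pow_mul]
        norm_num
      rw [h4]
      gcongr
      · linarith
      · norm_num
  · intro hgap
    have h := ModelSelection.corralRegret_le_of_drift_pow hC hT hK hL one_ne_zero
      fun hk b j hb hbj hjk => by
        simpa only [pow_one] using
          ModelSelection.exists_drift_of_gap hα hC hT hK hL hgap hk hb hbj hjk
    simpa only [pow_one] using h
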